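/- Let $a_1<a_2<a_3<a_4$ be real numbers, $P(x)=\prod_{i=1}^4(x-a_i)$, $\sigma=\frac14\sum_{i=1}^4 a_i$, and $$L\psi=(P\psi')'+2(x-\sigma)^2\psi .$$ Let $D_{\max}$ be the set of functions $\psi$ on $(a_2,a_3)\cup(a_3,a_4)$ such that, on each of the intervals $I=(a_2,a_3)$ and $I=(a_3,a_4)$, the functions $\psi$ and $P\psi'$ are absolutely continuous on compact subintervals of $I$ and $\psi,\,L\psi\in L^2(I)$ (complex-valued functions). Put $[f,g]=fP\overline{g}'-\overline{g}Pf'$, with $[f,g](a_i^\pm)$ denoting one-sided limits, and let $$u(y)=1,\qquad v(y)=\sum_{i=1}^4\Big(\prod_{j\ne i}\frac1{a_i-a_j}\Big)\ln|y-a_i| .$$ Let $L_S\psi=L\psi$ be the operator in $L^2(a_2,a_4)$ with domain $$D(L_S)=\{\psi\in D_{\max}:\ [\psi,u](a_2^+)=[\psi,u](a_4^-)=0,\ [\psi,u](a_3^-)=[\psi,u](a_3^+),\ [\psi,v](a_3^-)=[\psi,v](a_3^+)\}.$$ Then $L_S$ is self-adjoint, the resolvent $(L_S-i)^{-1}$ exists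 as a bounded operator on $L^2(a_2,a_4)$ and is compact, and $L_S$ has purely discrete spectrum: every point of the spectrum is isolated in the spectrum and is an eigenvalue of finite multiplicity. Moreover, the eigenfunctions of $L_S$ are complete: there is a complete orthonormal system $(f_n)_{n\in\mathbb N}$ of $L^2(a_2,a_4)$ consisting of eigenfunctions of $L_S$, with real eigenvalues. -/

import Mathlib

open MeasureTheory Filter Topology Set

noncomputable section

namespace TruncatedHilbert

/-! ### The differential expression

The four real points `a₁ < a₂ < a₃ < a₄` are `a 0 < a 1 < a 2 < a 3`. -/

/-- `P(x) = ∏ᵢ (x - aᵢ)`. -/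
def P (a : Fin 4 → ℝ) (x : ℝ) : ℝ := ∏ i, (x - a i)

/-- `σ = (a₁ + a₂ + a₃ + a₄) / 4`. -/
def σ (a : Fin 4 → ℝ) : ℝ := (1 / 4) * ∑ i, a i

/-- The quasi-derivative `P ψ'`. -/
def quasi (a : Fin 4 → ℝ) (ψ : ℝ → ℂ) (x : ℝ) : ℂ := (P a x : ℂ) * deriv ψ x

/-- `L ψ = (P ψ')' + 2 (x - σ)² ψ`. -/
def L (a : Fin 4 → ℝ) (ψ : ℝ → ℂ) (x : ℝ) : ℂ :=
  deriv (quasi a ψ) x + 2 * ((x - σ a : ℝ) : ℂ) ^ 2 * ψ x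

/-- `f` is absolutely continuous on all compact subintervals of the open interval `(l, r)`. -/
def ACLoc (f : ℝ → ℂ) (l r : ℝ) : Prop :=
  ∀ c d : ℝ, l < c → c ≤ d → d < r → AbsolutelyContinuousOnInterval f c d

/-- Membership in the maximal domain on the interval `(l, r)`. -/
structure MemDmaxOn (a : Fin 4 → ℝ) (l r : ℝ) (ψ : ℝ → ℂ) : Prop where
  ac : ACLoc ψ l r
  ac_quasi : ACLoc (quasi a ψ) l r
  memLp : MemLp ψ 2 (volume.restrict (Ioo l r))
  memLp_L : MemLp (L a ψ) 2 (volume.restrict (Ioo l r))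

/-- Membership in `D_max`, the direct sum of the maximal domains on `(a₂, a₃)` and `(a₃, a₄)`. -/
structure MemDmax (a : Fin 4 → ℝ) (ψ : ℝ → ℂ) : Prop where
  left : MemDmaxOn a (a 1) (a 2) ψ
  right : MemDmaxOn a (a 2) (a 3) ψ

/-- The Lagrange form `[f, g] = f P ḡ' - ḡ P f'`. -/
def lagrange (a : Fin 4 → ℝ) (f g : ℝ → ℂ) (x : ℝ) : ℂ :=
  f x * quasi a (fun y => (starRingEnd ℂ) (g y)) x - (starRingEnd ℂ) (g x) * quasi a f x

/-- The maximal domain function `u = 1`. -/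
def u : ℝ → ℂ := fun _ => 1

/-- The maximal domain function `v(y) = ∑ᵢ (∏_{j ≠ i} 1 / (aᵢ - aⱼ)) ln |y - aᵢ|`. -/
def v (a : Fin 4 → ℝ) : ℝ → ℂ := fun y =>
  ((∑ i, (∏ j ∈ Finset.univ.erase i, 1 / (a i - a j)) * Real.log |y - a i| : ℝ) : ℂ)

/-- Membership in `D(L_S)`: boundary conditions at `a₂⁺`, `a₄⁻` and transmission conditions
at `a₃`. -/
structure MemDomain (a : Fin 4 → ℝ) (ψ : ℝ → ℂ) : Prop where
  dmax : MemDmax a ψ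
  bc_left : Tendsto (lagrange a ψ u) (𝓝[>] (a 1)) (𝓝 0)
  bc_right : Tendsto (lagrange a ψ u) (𝓝[<] (a 3)) (𝓝 0)
  tc_u : ∃ l : ℂ, Tendsto (lagrange a ψ u) (𝓝[<] (a 2)) (𝓝 l) ∧
    Tendsto (lagrange a ψ u) (𝓝[>] (a 2)) (𝓝 l)
  tc_v : ∃ l : ℂ, Tendsto (lagrange a ψ (v a)) (𝓝[<] (a 2)) (𝓝 l) ∧
    Tendsto (lagrange a ψ (v a)) (𝓝[>] (a 2)) (𝓝 l)

/-! ### Regularity facts needed for linearity and well-definedness -/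

lemma P_ne_zero {a : Fin 4 → ℝ} {x : ℝ} (h : ∀ i, x ≠ a i) : P a x ≠ 0 :=
  Finset.prod_ne_zero_iff.mpr fun i _ => sub_ne_zero.mpr (h i)

lemma P_ne_zero_left {a : Fin 4 → ℝ} (ha : StrictMono a) {x : ℝ}
    (hx : x ∈ Ioo (a 1) (a 2)) : P a x ≠ 0 := by
  have h01 : a 0 < a 1 := ha (by decide)
  have h23 : a 2 < a 3 := ha (by decide)
  apply P_ne_zero
  intro i
  fin_cases i <;> simp only [Fin.zero_eta, Fin.mk_one, Fin.reduceFinMk] <;>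
    intro h <;> linarith [hx.1, hx.2]

lemma P_ne_zero_right {a : Fin 4 → ℝ} (ha : StrictMono a) {x : ℝ}
    (hx : x ∈ Ioo (a 2) (a 3)) : P a x ≠ 0 := by
  have h01 : a 0 < a 1 := ha (by decide)
  have h12 : a 1 < a 2 := ha (by decide)
  apply P_ne_zero
  intro i
  fin_cases i <;> simp only [Fin.zero_eta, Fin.mk_one, Fin.reduceFinMk] <;>
    intro h <;> linarith [hx.1, hx.2]

lemma continuous_P (a : Fin 4 → ℝ) : Continuous (P a) := by
  unfold P; fun_prop

lemma ACLoc.continuousOn {f : ℝ → ℂ} {l r : ℝ} (h : ACLoc f l r) :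
    ContinuousOn f (Ioo l r) := by
  intro x hx
  obtain ⟨c, hc1, hc2⟩ := exists_between hx.1
  obtain ⟨d, hd1, hd2⟩ := exists_between hx.2
  have h1 := (h c d hc1 (hc2.le.trans hd1.le) hd2).continuousOn
  rw [uIcc_of_le (hc2.le.trans hd1.le)] at h1
  exact (h1.continuousAt (Icc_mem_nhds hc2 hd1)).continuousWithinAt

lemma ACLoc.ae_differentiableAt {f : ℝ → ℂ} {l r : ℝ} (h : ACLoc f l r) :
    ∀ᵐ x, x ∈ Ioo l r → DifferentiableAt ℝ f x := by
  have hbv : LocallyBoundedVariationOn f (Ioo l r) := by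
    intro x y hx hy
    rcases le_total x y with hxy | hxy
    · have h1 := (h x y hx.1 hxy hy.2).boundedVariationOn
      rw [uIcc_of_le hxy] at h1
      exact h1.mono inter_subset_right
    · refine BoundedVariationOn.mono (s := Icc y y) ?_ ?_
      · have h1 := (h y y hy.1 le_rfl hy.2).boundedVariationOn
        rwa [uIcc_of_le le_rfl] at h1
      · intro z hz
        exact ⟨hxy.trans hz.2.1 |>.trans' le_rfl, hz.2.2⟩
  filter_upwards [hbv.ae_differentiableWithinAt_of_mem] with x hx hxm
  exact (hx hxm).differentiableAt (Ioo_mem_nhds hxm.1 hxm.2)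

/-- A function in the maximal domain is differentiable everywhere in the open interval. -/
lemma MemDmaxOn.differentiableAt {a : Fin 4 → ℝ} {l r : ℝ} {ψ : ℝ → ℂ}
    (h : MemDmaxOn a l r ψ) (hP : ∀ x ∈ Ioo l r, P a x ≠ 0) {x : ℝ} (hx : x ∈ Ioo l r) :
    DifferentiableAt ℝ ψ x := by
  obtain ⟨c, hc1, hc2⟩ := exists_between hx.1
  obtain ⟨d, hd1, hd2⟩ := exists_between hx.2
  have hcd : c ≤ d := hc2.le.trans hd1.le
  have hsub : Icc c d ⊆ Ioo l r := fun y hy => ⟨hc1.trans_le hy.1, hy.2.trans_lt hd2⟩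
  have hg : ContinuousOn (deriv ψ) (Icc c d) := by
    have h1 : ContinuousOn (fun y => quasi a ψ y / (P a y : ℂ)) (Icc c d) := by
      refine (h.ac_quasi.continuousOn.mono hsub).div ?_ ?_
      · exact (Complex.continuous_ofReal.comp (continuous_P a)).continuousOn
      · intro y hy
        exact_mod_cast hP y (hsub hy)
    refine h1.congr fun y hy => ?_
    have : (P a y : ℂ) ≠ 0 := by exact_mod_cast hP y (hsub hy)
    simp only [quasi]
    field_simp
  set G : ℝ → ℂ := IccExtend hcd ((Icc c d).domRestrict (deriv ψ)) with hG
  have hGc : Continuous G := (continuousOn_iff_continuous_domRestrict.mp hg).Icc_extend'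
  have hGeq : ∀ y ∈ Icc c d, G y = deriv ψ y := fun y hy => by
    rw [hG, IccExtend_of_mem hcd _ hy]; rfl
  set Φ : ℝ → ℂ := fun y => ∫ t in c..y, G t with hΦ
  have hΦd : ∀ y, HasDerivAt Φ (G y) y := fun y =>
    hGc.deriv_integral G c y ▸
      (intervalIntegral.integral_hasDerivAt_right (hGc.intervalIntegrable c y)
        (hGc.stronglyMeasurableAtFilter _ _) hGc.continuousAt).differentiableAt.hasDerivAt
  have hΦ1 : ContDiff ℝ 1 Φ := by
    rw [contDiff_one_iff_deriv]
    refine ⟨fun y => (hΦd y).differentiableAt, ?_⟩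
    rw [funext fun y => (hΦd y).deriv]
    exact hGc
  have hac : AbsolutelyContinuousOnInterval (ψ - Φ) c d :=
    (h.ac c d hc1 hcd hd2).sub hΦ1.contDiffOn.absolutelyContinuousOnInterval
  obtain ⟨C, hC⟩ := hac.const_of_ae_hasDerivAt_zero (by
    filter_upwards [h.ac.ae_differentiableAt] with y hy hym
    rw [uIcc_of_le hcd] at hym
    have := (hy (hsub hym)).hasDerivAt.sub (hΦd y)
    rwa [hGeq y hym, sub_self] at this)
  rw [uIcc_of_le hcd] at hC
  have heq : ψ =ᶠ[𝓝 x] fun y => C + Φ y := by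
    filter_upwards [Icc_mem_nhds hc2 hd1] with y hy
    rw [← hC y hy]; simp
  exact (((hΦd x).differentiableAt.const_add C)).congr_of_eventuallyEq heq

lemma quasi_add {a : Fin 4 → ℝ} {ψ φ : ℝ → ℂ} {x : ℝ} (h1 : DifferentiableAt ℝ ψ x)
    (h2 : DifferentiableAt ℝ φ x) : quasi a (ψ + φ) x = quasi a ψ x + quasi a φ x := by
  simp only [quasi, deriv_add h1 h2]; ring

lemma quasi_smul {a : Fin 4 → ℝ} (c : ℂ) (ψ : ℝ → ℂ) :
    quasi a (c • ψ) = c • quasi a ψ := by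
  funext x
  simp only [quasi, Pi.smul_apply, smul_eq_mul, deriv_const_smul_field]
  ring

lemma L_smul {a : Fin 4 → ℝ} (c : ℂ) (ψ : ℝ → ℂ) : L a (c • ψ) = c • L a ψ := by
  funext x
  simp only [L, quasi_smul, Pi.smul_apply, smul_eq_mul, deriv_const_smul_field]
  ring

lemma lagrange_smul {a : Fin 4 → ℝ} (c : ℂ) (ψ g : ℝ → ℂ) :
    lagrange a (c • ψ) g = fun x => c * lagrange a ψ g x := by
  funext x
  simp only [lagrange, quasi_smul, Pi.smul_apply, smul_eq_mul]
  ring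

lemma ACLoc.congr {f g : ℝ → ℂ} {l r : ℝ} (h : ACLoc f l r) (hfg : EqOn f g (Ioo l r)) :
    ACLoc g l r := by
  intro c d hc hcd hd
  have h1 := h c d hc hcd hd
  rw [absolutelyContinuousOnInterval_iff] at h1 ⊢
  intro ε hε
  obtain ⟨δ, hδ, H⟩ := h1 ε hε
  refine ⟨δ, hδ, fun E hE hlen => ?_⟩
  have hsub : uIcc c d ⊆ Ioo l r := by
    rw [uIcc_of_le hcd]
    exact fun y hy => ⟨hc.trans_le hy.1, hy.2.trans_lt hd⟩
  refine lt_of_eq_of_lt (Finset.sum_congr rfl fun i hi => ?_) (H E hE hlen)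
  have := hE.1 i hi
  rw [hfg (hsub this.1), hfg (hsub this.2)]

/-- `L` is additive almost everywhere on the maximal domain. -/
lemma L_add_ae {a : Fin 4 → ℝ} {l r : ℝ} {ψ φ : ℝ → ℂ} (hψ : MemDmaxOn a l r ψ)
    (hφ : MemDmaxOn a l r φ) (hP : ∀ x ∈ Ioo l r, P a x ≠ 0) :
    ∀ᵐ x, x ∈ Ioo l r → L a (ψ + φ) x = L a ψ x + L a φ x := by
  filter_upwards [hψ.ac_quasi.ae_differentiableAt, hφ.ac_quasi.ae_differentiableAt]
    with x h1 h2 hx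
  have heq : quasi a (ψ + φ) =ᶠ[𝓝 x] quasi a ψ + quasi a φ := by
    filter_upwards [Ioo_mem_nhds hx.1 hx.2] with y hy
    exact quasi_add (hψ.differentiableAt hP hy) (hφ.differentiableAt hP hy)
  simp only [L, heq.deriv_eq, deriv_add (h1 hx) (h2 hx), Pi.add_apply]
  ring

lemma MemDmaxOn.add {a : Fin 4 → ℝ} {l r : ℝ} {ψ φ : ℝ → ℂ} (hψ : MemDmaxOn a l r ψ)
    (hφ : MemDmaxOn a l r φ) (hP : ∀ x ∈ Ioo l r, P a x ≠ 0) :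
    MemDmaxOn a l r (ψ + φ) where
  ac := fun c d h1 h2 h3 => (hψ.ac c d h1 h2 h3).add (hφ.ac c d h1 h2 h3)
  ac_quasi := by
    have h : ACLoc (quasi a ψ + quasi a φ) l r := fun c d h1 h2 h3 =>
      (hψ.ac_quasi c d h1 h2 h3).add (hφ.ac_quasi c d h1 h2 h3)
    exact h.congr fun x hx =>
      (quasi_add (hψ.differentiableAt hP hx) (hφ.differentiableAt hP hx)).symm
  memLp := hψ.memLp.add hφ.memLp
  memLp_L := by
    refine (memLp_congr_ae ?_).mpr (hψ.memLp_L.add hφ.memLp_L)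
    exact (ae_restrict_iff' measurableSet_Ioo).mpr (L_add_ae hψ hφ hP)

lemma MemDmaxOn.smul {a : Fin 4 → ℝ} {l r : ℝ} {ψ : ℝ → ℂ} (hψ : MemDmaxOn a l r ψ) (c : ℂ) :
    MemDmaxOn a l r (c • ψ) where
  ac := fun p q h1 h2 h3 => (hψ.ac p q h1 h2 h3).const_smul c
  ac_quasi := by
    rw [quasi_smul]
    exact fun p q h1 h2 h3 => (hψ.ac_quasi p q h1 h2 h3).const_smul c
  memLp := hψ.memLp.const_smul c
  memLp_L := by
    rw [L_smul]
    exact hψ.memLp_L.const_smul c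

lemma MemDmax.differentiableAt {a : Fin 4 → ℝ} (ha : StrictMono a) {ψ : ℝ → ℂ}
    (h : MemDmax a ψ) {x : ℝ} (hx : x ∈ Ioo (a 1) (a 2) ∪ Ioo (a 2) (a 3)) :
    DifferentiableAt ℝ ψ x := by
  rcases hx with hx | hx
  · exact h.left.differentiableAt (fun y hy => P_ne_zero_left ha hy) hx
  · exact h.right.differentiableAt (fun y hy => P_ne_zero_right ha hy) hx

lemma lagrange_add {a : Fin 4 → ℝ} (ha : StrictMono a) {ψ φ : ℝ → ℂ} (hψ : MemDmax a ψ)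
    (hφ : MemDmax a φ) (g : ℝ → ℂ) {x : ℝ} (hx : x ∈ Ioo (a 1) (a 2) ∪ Ioo (a 2) (a 3)) :
    lagrange a ψ g x + lagrange a φ g x = lagrange a (ψ + φ) g x := by
  simp only [lagrange, quasi_add (hψ.differentiableAt ha hx) (hφ.differentiableAt ha hx),
    Pi.add_apply]
  ring

lemma eventually_mem {a : Fin 4 → ℝ} (ha : StrictMono a) :
    (∀ᶠ x in 𝓝[>] (a 1), x ∈ Ioo (a 1) (a 2) ∪ Ioo (a 2) (a 3)) ∧
    (∀ᶠ x in 𝓝[<] (a 2), x ∈ Ioo (a 1) (a 2) ∪ Ioo (a 2) (a 3)) ∧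
    (∀ᶠ x in 𝓝[>] (a 2), x ∈ Ioo (a 1) (a 2) ∪ Ioo (a 2) (a 3)) ∧
    (∀ᶠ x in 𝓝[<] (a 3), x ∈ Ioo (a 1) (a 2) ∪ Ioo (a 2) (a 3)) := by
  have h12 : a 1 < a 2 := ha (by decide)
  have h23 : a 2 < a 3 := ha (by decide)
  refine ⟨?_, ?_, ?_, ?_⟩
  · filter_upwards [Ioo_mem_nhdsGT h12] with x hx using Or.inl hx
  · filter_upwards [Ioo_mem_nhdsLT h12] with x hx using Or.inl hx
  · filter_upwards [Ioo_mem_nhdsGT h23] with x hx using Or.inr hx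
  · filter_upwards [Ioo_mem_nhdsLT h23] with x hx using Or.inr hx

lemma MemDomain.add {a : Fin 4 → ℝ} (ha : StrictMono a) {ψ φ : ℝ → ℂ} (hψ : MemDomain a ψ)
    (hφ : MemDomain a φ) : MemDomain a (ψ + φ) := by
  obtain ⟨e1, e2, e3, e4⟩ := eventually_mem ha
  have key : ∀ (g : ℝ → ℂ) {F : Filter ℝ} {l m : ℂ},
      (∀ᶠ x in F, x ∈ Ioo (a 1) (a 2) ∪ Ioo (a 2) (a 3)) →
      Tendsto (lagrange a ψ g) F (𝓝 l) → Tendsto (lagrange a φ g) F (𝓝 m) →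
      Tendsto (lagrange a (ψ + φ) g) F (𝓝 (l + m)) := by
    intro g F l m hF h1 h2
    refine (h1.add h2).congr' ?_
    filter_upwards [hF] with x hx using lagrange_add ha hψ.dmax hφ.dmax g hx
  refine ⟨⟨hψ.dmax.left.add hφ.dmax.left fun y hy => P_ne_zero_left ha hy,
    hψ.dmax.right.add hφ.dmax.right fun y hy => P_ne_zero_right ha hy⟩, ?_, ?_, ?_, ?_⟩
  · simpa using key u e1 hψ.bc_left hφ.bc_left
  · simpa using key u e4 hψ.bc_right hφ.bc_right
  · obtain ⟨l, h1, h2⟩ := hψ.tc_u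
    obtain ⟨m, h3, h4⟩ := hφ.tc_u
    exact ⟨l + m, key u e2 h1 h3, key u e3 h2 h4⟩
  · obtain ⟨l, h1, h2⟩ := hψ.tc_v
    obtain ⟨m, h3, h4⟩ := hφ.tc_v
    exact ⟨l + m, key (v a) e2 h1 h3, key (v a) e3 h2 h4⟩

lemma MemDomain.smul {a : Fin 4 → ℝ} {ψ : ℝ → ℂ} (hψ : MemDomain a ψ) (c : ℂ) :
    MemDomain a (c • ψ) := by
  refine ⟨⟨hψ.dmax.left.smul c, hψ.dmax.right.smul c⟩, ?_, ?_, ?_, ?_⟩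
  · rw [lagrange_smul]; simpa using hψ.bc_left.const_mul c
  · rw [lagrange_smul]; simpa using hψ.bc_right.const_mul c
  · obtain ⟨l, h1, h2⟩ := hψ.tc_u
    rw [lagrange_smul]
    exact ⟨c * l, h1.const_mul c, h2.const_mul c⟩
  · obtain ⟨l, h1, h2⟩ := hψ.tc_v
    rw [lagrange_smul]
    exact ⟨c * l, h1.const_mul c, h2.const_mul c⟩

lemma quasi_zero (a : Fin 4 → ℝ) : quasi a 0 = 0 := by
  simpa using quasi_smul (a := a) 0 (0 : ℝ → ℂ)

lemma L_zero (a : Fin 4 → ℝ) : L a 0 = 0 := by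
  simpa using L_smul (a := a) 0 (0 : ℝ → ℂ)

lemma memDomain_zero (a : Fin 4 → ℝ) : MemDomain a 0 := by
  have hac : ∀ l r, ACLoc 0 l r := fun l r c d _ _ _ =>
    (contDiff_const (c := (0 : ℂ))).contDiffOn.absolutelyContinuousOnInterval
  have hd : ∀ l r, MemDmaxOn a l r 0 := fun l r =>
    ⟨hac l r, by rw [quasi_zero]; exact hac l r, MemLp.zero, by rw [L_zero]; exact MemLp.zero⟩
  have hl : ∀ g, lagrange a 0 g = fun _ => 0 := fun g => by
    funext x; simp [lagrange, quasi_zero]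
  refine ⟨⟨hd _ _, hd _ _⟩, ?_, ?_, ⟨0, ?_, ?_⟩, ⟨0, ?_, ?_⟩⟩ <;> rw [hl] <;>
    exact tendsto_const_nhds

/-! ### The operator `L_S` in `L²(a₂, a₄)` -/

/-- Lebesgue measure on `(a₂, a₄)`. -/
abbrev μ (a : Fin 4 → ℝ) : Measure ℝ := volume.restrict (Ioo (a 1) (a 3))

/-- The complex Hilbert space `L²(a₂, a₄)`. -/
abbrev H (a : Fin 4 → ℝ) : Type := Lp ℂ 2 (μ a)

lemma ae_of_ae {a : Fin 4 → ℝ} {p : ℝ → Prop}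
    (h1 : ∀ᵐ x, x ∈ Ioo (a 1) (a 2) → p x) (h2 : ∀ᵐ x, x ∈ Ioo (a 2) (a 3) → p x) :
    ∀ᵐ x ∂(μ a), p x := by
  rw [ae_restrict_iff' measurableSet_Ioo]
  have h3 : ∀ᵐ x : ℝ, x ≠ a 2 := by simp [ae_iff]
  filter_upwards [h1, h2, h3] with x h1 h2 h3 hx
  rcases lt_or_gt_of_ne h3 with h | h
  · exact h1 ⟨hx.1, h⟩
  · exact h2 ⟨h, hx.2⟩

/-- The graph of `L_S`: pairs of classes `(f, g)` in `L²(a₂, a₄)` such that `f` is the class of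
some `ψ ∈ D(L_S)` and `g` is the class of `L ψ`. -/
def graphLS (a : Fin 4 → ℝ) (ha : StrictMono a) : Submodule ℂ (H a × H a) where
  carrier := {p | ∃ ψ : ℝ → ℂ, MemDomain a ψ ∧ p.1 =ᵐ[μ a] ψ ∧ p.2 =ᵐ[μ a] L a ψ}
  zero_mem' := by
    refine ⟨0, memDomain_zero a, Lp.coeFn_zero _ _ _, ?_⟩
    rw [L_zero]
    exact Lp.coeFn_zero _ _ _
  add_mem' := by
    rintro p q ⟨ψ, hψ, h1, h2⟩ ⟨φ, hφ, h3, h4⟩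
    refine ⟨ψ + φ, hψ.add ha hφ, (Lp.coeFn_add p.1 q.1).trans (h1.add h3),
      (Lp.coeFn_add p.2 q.2).trans ((h2.add h4).trans ?_)⟩
    refine ae_of_ae ?_ ?_
    · filter_upwards [L_add_ae hψ.dmax.left hφ.dmax.left fun y hy => P_ne_zero_left ha hy]
        with x hx hm using (hx hm).symm
    · filter_upwards [L_add_ae hψ.dmax.right hφ.dmax.right fun y hy => P_ne_zero_right ha hy]
        with x hx hm using (hx hm).symm
  smul_mem' := by
    rintro c p ⟨ψ, hψ, h1, h2⟩
    refine ⟨c • ψ, hψ.smul c, (Lp.coeFn_smul c p.1).trans (h1.const_smul c), ?_⟩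
    rw [L_smul]
    exact (Lp.coeFn_smul c p.2).trans (h2.const_smul c)

/-- The operator `L_S : D(L_S) → L²(a₂, a₄)`, `L_S ψ = L ψ`. -/
def LS (a : Fin 4 → ℝ) (ha : StrictMono a) : H a →ₗ.[ℂ] H a := (graphLS a ha).toLinearPMap

/-- `graphLS` is single-valued: two elements of `D(L_S)` that agree almost everywhere have the
same image under `L`. -/
lemma graphLS_single_valued (a : Fin 4 → ℝ) (ha : StrictMono a) :
    ∀ p ∈ graphLS a ha, p.1 = 0 → p.2 = 0 := by
  rintro p ⟨ψ, hψ, h1, h2⟩ h0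
  have hψ0 : ψ =ᵐ[μ a] (0 : ℝ → ℂ) := by
    rw [h0] at h1
    exact h1.symm.trans (Lp.coeFn_zero _ _ _)
  have h12 : a 1 < a 2 := ha (by decide)
  have h23 : a 2 < a 3 := ha (by decide)
  have key : ∀ l r : ℝ, Ioo l r ⊆ Ioo (a 1) (a 3) → MemDmaxOn a l r ψ →
      ∀ x ∈ Ioo l r, L a ψ x = 0 := by
    intro l r hs hm x hx
    have hz : EqOn ψ 0 (Ioo l r) :=
      Measure.eqOn_open_of_ae_eq (ae_restrict_of_ae_restrict_of_subset hs hψ0) isOpen_Ioo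
        hm.ac.continuousOn continuousOn_const
    have hq : ∀ y ∈ Ioo l r, quasi a ψ y = 0 := fun y hy => by
      have : ψ =ᶠ[𝓝 y] fun _ => 0 := by
        filter_upwards [Ioo_mem_nhds hy.1 hy.2] with z hz' using hz hz'
      simp [quasi, this.deriv_eq]
    have : quasi a ψ =ᶠ[𝓝 x] fun _ => 0 := by
      filter_upwards [Ioo_mem_nhds hx.1 hx.2] with z hz' using hq z hz'
    simp [L, this.deriv_eq, hz hx]
  have hL : L a ψ =ᵐ[μ a] (0 : ℝ → ℂ) := ae_of_ae
    (Eventually.of_forall fun x hx => key _ _ (Ioo_subset_Ioo_right h23.le) hψ.dmax.left x hx)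
    (Eventually.of_forall fun x hx => key _ _ (Ioo_subset_Ioo_left h12.le) hψ.dmax.right x hx)
  exact Lp.ext ((h2.trans hL).trans (Lp.coeFn_zero _ _ _).symm)

/-- `(f, g)` lies on the graph of `L_S` iff `f` is represented by some `ψ ∈ D(L_S)` and `g` by
`L ψ`. -/
theorem mem_graph_LS {a : Fin 4 → ℝ} {ha : StrictMono a} {f g : H a} :
    (f, g) ∈ (LS a ha).graph ↔
      ∃ ψ : ℝ → ℂ, MemDomain a ψ ∧ f =ᵐ[μ a] ψ ∧ g =ᵐ[μ a] L a ψ := by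
  rw [LS, Submodule.toLinearPMap_graph_eq _ (graphLS_single_valued a ha)]
  rfl

/-! ### Spectral notions for unbounded operators -/

variable {E : Type*} [NormedAddCommGroup E] [InnerProductSpace ℂ E]

/-- `R` is the bounded, everywhere defined inverse of `T - z : D(T) → E`. -/
structure IsResolventAt (T : E →ₗ.[ℂ] E) (z : ℂ) (R : E →L[ℂ] E) : Prop where
  mem_domain : ∀ x, R x ∈ T.domain
  right_inv : ∀ x, T ⟨R x, mem_domain x⟩ - z • R x = x
  left_inv : ∀ x : T.domain, R (T x - z • (x : E)) = x

/-- The resolvent set: those `z` for which `T - z : D(T) → E` has a bounded, everywhere defined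
inverse. -/
def resolventSet (T : E →ₗ.[ℂ] E) : Set ℂ := {z | ∃ R : E →L[ℂ] E, IsResolventAt T z R}

/-- The spectrum, the complement of the resolvent set. -/
def spec (T : E →ₗ.[ℂ] E) : Set ℂ := (resolventSet T)ᶜ

/-- The eigenspace `ker (T - z)`. -/
def eigenspace (T : E →ₗ.[ℂ] E) (z : ℂ) : Submodule ℂ E :=
  (LinearMap.ker (T.toFun - z • T.domain.subtype)).map T.domain.subtype

/-- The spectrum is purely discrete: each of its points is isolated in the spectrum and is an
eigenvalue of finite multiplicity. -/
def HasPurelyDiscreteSpectrum (T : E →ₗ.[ℂ] E) : Prop :=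
  ∀ z ∈ spec T, ¬ AccPt z (𝓟 (spec T)) ∧ eigenspace T z ≠ ⊥ ∧
    FiniteDimensional ℂ (eigenspace T z)

end TruncatedHilbert

end

noncomputable section

namespace TruncatedHilbert

open scoped InnerProductSpace ENNReal BoundedContinuousFunction

variable {E : Type*} [NormedAddCommGroup E] [InnerProductSpace ℂ E]

/-! The idea is to show that, up to a bounded potential, `L_S` is the inverse of a compact operator.
Since `v' = 1/P`, the equation `(P ψ')' = f` is solved on both intervals at once by `c + ∫_{a₂}^x
(v(x) - v(t)) f(t) dt`, whose quasi-derivative is `∫_{a₂}^x f`. A general solution has two constants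
on each interval. The condition at `a₂` and the two conditions at `a₃` reduce these four to the
single constant `c`, and the condition at `a₄` becomes `∫ f = 0`. Hence (`memDomain_sol`,
`MemDomain.exists_eq_sol`, `mem_graph_LS_iff`) the graph of `L_S` consists of the pairs `(c + G f, f
+ M (c + G f))` with `f ⊥ 1`, where `G` is `solOp` and `M` is multiplication by `2 (x - σ)²`.

`G` is built from maps `f ↦ g ∫ h f` with `g, h ∈ L²`. These factor through continuous functions on
`[a₂, a₄]` and are compact by Arzelà–Ascoli. Integration by parts makes `G` symmetric on `1^⊥`
(`inner_solOp`). Adding the projection onto constants removes the kernel and the range defect, so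
`L_S = A⁻¹ + B` with `A` compact, symmetric, injective and `B` bounded, symmetric
(`exists_isInvCompactAdd`).

The rest is abstract. Self-adjointness follows by testing the adjoint relation against the range of
`A`. By the Fredholm alternative every `z` that is not an eigenvalue has a compact resolvent, in
particular `z = i`. Separability provides a real `t` that is not an eigenvalue. The resolvent at `t`
is compact, symmetric and injective, so its spectral theorem yields the discreteness and the
eigenbasis. -/

/-! ### Compact symmetric operators on inner product spaces -/

lemma norm_sub_mul_self_of_inner_eq_zero {x y : E} (h : ⟪x, y⟫_ℂ = 0) :
    ‖x - y‖ * ‖x - y‖ = ‖x‖ * ‖x‖ + ‖y‖ * ‖y‖ := by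
  have := norm_add_sq_eq_norm_sq_add_norm_sq_of_inner_eq_zero x (-y) (𝕜 := ℂ)
    (by rw [inner_neg_right, h, neg_zero])
  rwa [← sub_eq_add_neg, norm_neg] at this

/-- An orthonormal family in a separable space is countable. -/
lemma _root_.Orthonormal.countable [TopologicalSpace.SeparableSpace E] {ι : Type*} {f : ι → E}
    (hf : Orthonormal ℂ f) : Countable ι := by
  rw [← Set.countable_univ_iff]
  -- Distinct members are at distance `√2 > 1`, so the balls of radius `1/2` are disjoint.
  refine Set.PairwiseDisjoint.countable_of_isOpen (s := fun i => Metric.ball (f i) (1 / 2)) ?_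
    (fun _ _ => Metric.isOpen_ball) (fun i _ => ⟨f i, Metric.mem_ball_self (by norm_num)⟩)
  intro i _ j _ hij
  refine Metric.ball_disjoint_ball ?_
  have h : ‖f i - f j‖ * ‖f i - f j‖ = ‖f i‖ * ‖f i‖ + ‖f j‖ * ‖f j‖ :=
    norm_sub_mul_self_of_inner_eq_zero (hf.2 hij)
  rw [hf.1 i, hf.1 j] at h
  rw [dist_eq_norm]
  nlinarith [norm_nonneg (f i - f j)]

/-- A compact symmetric operator has only finitely many eigenvalues outside a ball around `0`. -/
lemma finite_eigenvalues_of_compact {R : E →L[ℂ] E} (hR : IsCompactOperator R)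
    (hs : (R : E →ₗ[ℂ] E).IsSymmetric) {ε : ℝ} (hε : 0 < ε) :
    {w : ℂ | Module.End.HasEigenvalue (R : E →ₗ[ℂ] E) w ∧ ε ≤ ‖w‖}.Finite := by
  by_contra hinf
  set S := {w : ℂ | Module.End.HasEigenvalue (R : E →ₗ[ℂ] E) w ∧ ε ≤ ‖w‖}
  let w : ℕ → ℂ := fun n => (Set.Infinite.natEmbedding S hinf n : ℂ)
  have hw : ∀ n, w n ∈ S := fun n => (Set.Infinite.natEmbedding S hinf n).2
  have hinj : Function.Injective w := fun m n h =>
    (Set.Infinite.natEmbedding S hinf).injective (Subtype.ext h)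
  choose y hy using fun n => (hw n).1.exists_hasEigenvector
  let x : ℕ → E := fun n => ((‖y n‖ : ℂ)⁻¹) • y n
  have hx1 : ∀ n, ‖x n‖ = 1 := fun n => by
    have : ‖y n‖ ≠ 0 := norm_ne_zero_iff.mpr (hy n).2
    simp [x, norm_smul, this]
  have hx : ∀ n, R (x n) = w n • x n := fun n => by
    have : R (y n) = w n • y n := Module.End.mem_eigenspace_iff.mp (hy n).1
    simp only [x, map_smul, this, smul_comm (w n)]
  have horth : ∀ m n, m ≠ n → ⟪R (x m), R (x n)⟫_ℂ = 0 := fun m n hmn => by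
    have h0 : ⟪x m, x n⟫_ℂ = 0 :=
      hs.orthogonalFamily_eigenspaces (hinj.ne hmn)
        ⟨x m, Module.End.mem_eigenspace_iff.mpr (hx m)⟩
        ⟨x n, Module.End.mem_eigenspace_iff.mpr (hx n)⟩
    rw [hx, hx, inner_smul_left, inner_smul_right, h0]
    simp
  have hdist : ∀ m n, m ≠ n → ε ≤ dist (R (x m)) (R (x n)) := fun m n hmn => by
    have h : ‖R (x m) - R (x n)‖ * ‖R (x m) - R (x n)‖ =
        ‖R (x m)‖ * ‖R (x m)‖ + ‖R (x n)‖ * ‖R (x n)‖ :=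
      norm_sub_mul_self_of_inner_eq_zero (horth m n hmn)
    have hm : ε ≤ ‖R (x m)‖ := by
      rw [hx, norm_smul, hx1, mul_one]; exact (hw m).2
    rw [dist_eq_norm]
    nlinarith [norm_nonneg (R (x m) - R (x n)), norm_nonneg (R (x n))]
  obtain ⟨K, hK, hsub⟩ := hR.image_closedBall_subset_compact 1
  obtain ⟨l, -, φ, hφ, hl⟩ := hK.tendsto_subseq (x := fun n => R (x n))
    fun n => hsub ⟨x n, by simp [hx1], rfl⟩
  obtain ⟨N, hN⟩ := Metric.cauchySeq_iff.mp hl.cauchySeq ε hε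
  exact absurd (hN N le_rfl (N + 1) N.le_succ)
    (not_lt.mpr (hdist _ _ (hφ.injective.ne N.succ_ne_self.symm)))

/-- An infinite-dimensional separable Hilbert space has an orthonormal basis, indexed by `ℕ`, of
eigenvectors of a given injective compact symmetric operator. -/
lemma exists_hilbertBasis_eigenvectors [CompleteSpace E] [TopologicalSpace.SeparableSpace E]
    (hinf : ¬ FiniteDimensional ℂ E) {R : E →L[ℂ] E} (hR : IsCompactOperator R)
    (hs : (R : E →ₗ[ℂ] E).IsSymmetric) (hinj : ∀ x, R x = 0 → x = 0) :
    ∃ (f : HilbertBasis ℕ ℂ E) (w : ℕ → ℂ), ∀ n, R (f n) = w n • f n := by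
  let T : Module.End ℂ E := (R : E →ₗ[ℂ] E)
  -- Compactness handles `w ≠ 0`; the case `w = 0` is where injectivity enters.
  have hfin : ∀ w, FiniteDimensional ℂ (Module.End.eigenspace T w) := fun w => by
    rcases eq_or_ne w 0 with rfl | hw
    · have : Module.End.eigenspace T 0 = ⊥ := by
        rw [eq_bot_iff]
        intro x hx
        rw [Module.End.mem_eigenspace_iff, zero_smul] at hx
        exact hinj x hx
      rw [this]
      infer_instance
    · exact ContinuousLinearMap.finite_dimensional_eigenspace hR w hw
  let b : ∀ w, OrthonormalBasis (Fin (Module.finrank ℂ (Module.End.eigenspace T w))) ℂ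
      (Module.End.eigenspace T w) := fun w => stdOrthonormalBasis ℂ _
  let F : (Σ w, Fin (Module.finrank ℂ (Module.End.eigenspace T w))) → E :=
    fun i => (b i.1 i.2 : E)
  have hF : Orthonormal ℂ F :=
    hs.orthogonalFamily_eigenspaces.orthonormal_sigma_orthonormal fun w => (b w).orthonormal
  have hspan : Submodule.span ℂ (range F) = ⨆ w, Module.End.eigenspace T w := by
    refine le_antisymm (Submodule.span_le.mpr ?_) (iSup_le fun w x hx => ?_)
    · rintro _ ⟨i, rfl⟩
      exact Submodule.mem_iSup_of_mem i.1 (b i.1 i.2).2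
    · have h := congrArg (Submodule.subtype _) ((b w).sum_repr ⟨x, hx⟩)
      rw [map_sum] at h
      simp only [Submodule.subtype_apply, map_smul] at h
      rw [← h]
      exact Submodule.sum_mem _ fun i _ => Submodule.smul_mem _ _
        (Submodule.subset_span ⟨⟨w, i⟩, rfl⟩)
  have hperp : (Submodule.span ℂ (range F))ᗮ = ⊥ := by
    rw [hspan]
    exact ContinuousLinearMap.orthogonalComplement_iSup_eigenspaces_eq_bot hR hs
  have := hF.countable
  have hinfi : Infinite (Σ w, Fin (Module.finrank ℂ (Module.End.eigenspace T w))) := by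
    by_contra hni
    have hfi := not_infinite_iff_finite.mp hni
    have : FiniteDimensional ℂ (Submodule.span ℂ (range F)) :=
      FiniteDimensional.span_of_finite ℂ (finite_range F)
    rw [Submodule.orthogonal_eq_bot_iff] at hperp
    rw [hperp] at this
    exact hinf (Module.Finite.equiv (Submodule.topEquiv (R := ℂ) (M := E)))
  obtain ⟨e⟩ : Nonempty (ℕ ≃ (Σ w, Fin (Module.finrank ℂ (Module.End.eigenspace T w)))) :=
    nonempty_equiv_of_countable
  refine ⟨HilbertBasis.mkOfOrthogonalEqBot (hF.comp e e.injective)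
    (by rwa [e.surjective.range_comp]), fun n => (e n).1, fun n => ?_⟩
  rw [HilbertBasis.coe_mkOfOrthogonalEqBot]
  exact Module.End.mem_eigenspace_iff.mp (b (e n).1 (e n).2).2

/-! ### Graphs, resolvents and eigenspaces -/

lemma mem_eigenspace_iff_mem_graph {T : E →ₗ.[ℂ] E} {z : ℂ} {y : E} :
    y ∈ eigenspace T z ↔ (y, z • y) ∈ T.graph := by
  rw [LinearPMap.mem_graph_iff, eigenspace, Submodule.mem_map]
  constructor
  · rintro ⟨x, hx, rfl⟩
    exact ⟨x, rfl, sub_eq_zero.mp hx⟩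
  · rintro ⟨x, rfl, hx⟩
    exact ⟨x, sub_eq_zero.mpr hx, rfl⟩

namespace IsResolventAt

variable {T : E →ₗ.[ℂ] E} {z : ℂ} {R : E →L[ℂ] E}

/-- A two-sided inverse of `T - z` determines `T`, so eigenvalue questions about the unbounded `T`
become equations in the bounded `R`. -/
lemma mem_graph_iff (h : IsResolventAt T z R) {f g : E} :
    (f, g) ∈ T.graph ↔ f = R (g - z • f) := by
  rw [LinearPMap.mem_graph_iff]
  constructor
  · rintro ⟨x, rfl, rfl⟩
    exact (h.left_inv x).symm
  · intro hf
    refine ⟨⟨f, hf ▸ h.mem_domain _⟩, rfl, ?_⟩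
    have h1 := h.right_inv (g - z • f)
    have h2 : (⟨R (g - z • f), h.mem_domain _⟩ : T.domain) = ⟨f, hf ▸ h.mem_domain _⟩ :=
      Subtype.ext hf.symm
    rw [h2] at h1
    have h3 : z • R (g - z • f) = z • f := by rw [← hf]
    rw [h3] at h1
    exact sub_left_injective h1

lemma injective (h : IsResolventAt T z R) {x : E} (hx : R x = 0) : x = 0 := by
  have h1 := h.right_inv x
  have h2 : (⟨R x, h.mem_domain x⟩ : T.domain) = 0 := Subtype.ext hx
  rw [h2, hx, smul_zero, sub_zero] at h1
  exact h1.symm.trans T.map_zero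

lemma mem_eigenspace_iff (h : IsResolventAt T z R) {w : ℂ} {y : E} :
    y ∈ eigenspace T w ↔ y = (w - z) • R y := by
  rw [mem_eigenspace_iff_mem_graph, h.mem_graph_iff, ← sub_smul, map_smul]

lemma eigenspace_eq (h : IsResolventAt T z R) {w : ℂ} (hw : w ≠ z) :
    eigenspace T w = Module.End.eigenspace (R : E →ₗ[ℂ] E) (w - z)⁻¹ := by
  have hwz : w - z ≠ 0 := sub_ne_zero.mpr hw
  ext y
  rw [h.mem_eigenspace_iff, Module.End.mem_eigenspace_iff, eq_inv_smul_iff₀ hwz, eq_comm]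
  rfl

lemma eigenspace_self (h : IsResolventAt T z R) : eigenspace T z = ⊥ := by
  rw [eq_bot_iff]
  intro y hy
  rw [h.mem_eigenspace_iff, sub_self, zero_smul] at hy
  exact hy

end IsResolventAt

/-! ### Spectral theory of `A⁻¹ + B` -/

/-- `T` is of the form `A⁻¹ + B` with `A` compact, symmetric and injective, and `B` bounded and
symmetric. -/
structure IsInvCompactAdd (T : E →ₗ.[ℂ] E) (A B : E →L[ℂ] E) : Prop where
  compact : IsCompactOperator A
  symm_left : (A : E →ₗ[ℂ] E).IsSymmetric
  symm_right : (B : E →ₗ[ℂ] E).IsSymmetric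
  injective : ∀ x, A x = 0 → x = 0
  mem_graph_iff : ∀ f g, (f, g) ∈ T.graph ↔ ∃ x, f = A x ∧ g = x + B (A x)

namespace IsInvCompactAdd

variable {T : E →ₗ.[ℂ] E} {A B : E →L[ℂ] E}

lemma inner_eq (h : IsInvCompactAdd T A B) {f g f' g' : E} (h1 : (f, g) ∈ T.graph)
    (h2 : (f', g') ∈ T.graph) : ⟪g, f'⟫_ℂ = ⟪f, g'⟫_ℂ := by
  obtain ⟨x, rfl, rfl⟩ := (h.mem_graph_iff _ _).mp h1
  obtain ⟨y, rfl, rfl⟩ := (h.mem_graph_iff _ _).mp h2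
  rw [inner_add_left, inner_add_right]
  congr 1
  · exact (h.symm_left x y).symm
  · exact h.symm_right _ _

/-- Testing `(y, w)` against the pairs `(A x, x + B A x)` gives `⟪x, A (w - B y)⟫ = ⟪x, y⟫`. Here
`x` runs over all of `E`, so `y = A (w - B y)`, which is membership in the graph. -/
lemma mem_adjoint_graph [CompleteSpace E] (h : IsInvCompactAdd T A B) (p : E × E) :
    p ∈ T.graph.adjoint ↔ p ∈ T.graph := by
  obtain ⟨y, w⟩ := p
  rw [Submodule.mem_adjoint_iff]
  constructor
  · intro H
    have key : A (w - B y) = y := by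
      refine ext_inner_left ℂ fun x => ?_
      have hx := H (A x) (x + B (A x)) ((h.mem_graph_iff _ _).mpr ⟨x, rfl, rfl⟩)
      have h1 : ⟪A x, w - B y⟫_ℂ = ⟪x, A (w - B y)⟫_ℂ := h.symm_left _ _
      have h2 : ⟪B (A x), y⟫_ℂ = ⟪A x, B y⟫_ℂ := h.symm_right _ _
      rw [inner_add_left, h2] at hx
      rw [← h1, inner_sub_right]
      linear_combination -hx
    exact (h.mem_graph_iff _ _).mpr ⟨w - B y, key.symm, by rw [key]; abel⟩
  · intro H f g hfg
    rw [h.inner_eq hfg H, sub_self]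

/-- The domain contains the range of `A`, whose orthogonal complement is `ker A = 0` by symmetry. -/
lemma dense_domain [CompleteSpace E] (h : IsInvCompactAdd T A B) :
    Dense (T.domain : Set E) := by
  rw [← Submodule.dense_iff_topologicalClosure_eq_top.symm,
    Submodule.topologicalClosure_eq_top_iff, eq_bot_iff]
  intro y hy
  refine h.injective y (ext_inner_left ℂ fun x => ?_)
  have h1 : ⟪A x, y⟫_ℂ = ⟪x, A y⟫_ℂ := h.symm_left _ _
  rw [← h1, inner_zero_right]
  refine (Submodule.mem_orthogonal _ _).mp hy _ ?_
  exact LinearPMap.mem_domain_of_mem_graph ((h.mem_graph_iff _ _).mpr ⟨x, rfl, rfl⟩)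

theorem isSelfAdjoint [CompleteSpace E] (h : IsInvCompactAdd T A B) : IsSelfAdjoint T := by
  rw [LinearPMap.isSelfAdjoint_def]
  refine LinearPMap.eq_of_eq_graph ?_
  rw [LinearPMap.adjoint_graph_eq_graph_adjoint h.dense_domain]
  ext p
  exact h.mem_adjoint_graph p

/-- On `f = A x` one has `(T - z) f = (1 + K) x` with `K = (B - z) A` compact. If `K x = -x` then `A
x` is an eigenvector of `T` at `z`. By the Fredholm alternative `1 + K` is therefore invertible, and
the resolvent is `A (1 + K)⁻¹`. -/
theorem exists_compact_resolvent [CompleteSpace E] (h : IsInvCompactAdd T A B) {z : ℂ}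
    (hz : eigenspace T z = ⊥) : ∃ R : E →L[ℂ] E, IsResolventAt T z R ∧ IsCompactOperator R := by
  let K : E →L[ℂ] E := (B - z • ContinuousLinearMap.id ℂ E) ∘L A
  have hK : IsCompactOperator K := h.compact.clm_comp (B - z • ContinuousLinearMap.id ℂ E)
  have hKa : ∀ x, K x = B (A x) - z • A x := fun x => rfl
  have hne : ¬ Module.End.HasEigenvalue (K : E →ₗ[ℂ] E) (-1) := by
    intro he
    obtain ⟨x, hx, hx0⟩ := he.exists_hasEigenvector
    have hx1 : K x = (-1 : ℂ) • x := Module.End.mem_eigenspace_iff.mp hx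
    have hmem : A x ∈ eigenspace T z := by
      rw [mem_eigenspace_iff_mem_graph, h.mem_graph_iff]
      refine ⟨x, rfl, ?_⟩
      rw [hKa, neg_smul, one_smul] at hx1
      rw [eq_comm, ← sub_eq_zero, add_sub_assoc, hx1, add_neg_cancel]
    rw [hz, Submodule.mem_bot] at hmem
    exact hx0 (h.injective x hmem)
  have hunit : IsUnit (algebraMap ℂ (E →L[ℂ] E) (-1) - K) :=
    (hK.hasEigenvalue_or_mem_resolventSet (by norm_num : (-1 : ℂ) ≠ 0)).resolve_left hne
  -- `S` is `-(1 + K)`, which accounts for the sign in front of `S⁻¹` below.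
  obtain ⟨S, hS⟩ := hunit
  have hSa : ∀ x, (S : E →L[ℂ] E) x = -(x + (B (A x) - z • A x)) := fun x => by
    rw [hS, sub_apply, Algebra.algebraMap_eq_smul_one, hKa]
    simp
    abel
  have hl : ∀ x, (↑S⁻¹ : E →L[ℂ] E) ((S : E →L[ℂ] E) x) = x := fun x =>
    congrArg (fun V : E →L[ℂ] E => V x) S.inv_mul
  have hr : ∀ x, (S : E →L[ℂ] E) ((↑S⁻¹ : E →L[ℂ] E) x) = x := fun x =>
    congrArg (fun V : E →L[ℂ] E => V x) S.mul_inv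
  have hgr : ∀ y, (A y, y + B (A y)) ∈ T.graph := fun y => (h.mem_graph_iff _ _).mpr ⟨y, rfl, rfl⟩
  refine ⟨A ∘L (-(↑S⁻¹ : E →L[ℂ] E)), ⟨fun x => ?_, fun x => ?_, fun u => ?_⟩,
    h.compact.comp_clm (-(↑S⁻¹ : E →L[ℂ] E))⟩
  · exact LinearPMap.mem_domain_of_mem_graph (hgr _)
  · set y := (-(↑S⁻¹ : E →L[ℂ] E)) x with hy
    have h1 : T ⟨A y, LinearPMap.mem_domain_of_mem_graph (hgr y)⟩ = y + B (A y) :=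
      ((LinearPMap.mem_graph_iff' T).mp (hgr y)).elim fun u hu => by
        have e1 : (u : E) = A y := congrArg Prod.fst hu
        have e2 : T u = y + B (A y) := congrArg Prod.snd hu
        have e3 : (⟨A y, LinearPMap.mem_domain_of_mem_graph (hgr y)⟩ : T.domain) = u :=
          Subtype.ext e1.symm
        exact (congrArg T e3).trans e2
    have h2 : (S : E →L[ℂ] E) y = -x := by
      rw [hy, neg_apply, map_neg, hr]
    rw [hSa, neg_inj] at h2
    calc T ⟨A y, _⟩ - z • A y = y + B (A y) - z • A y := by rw [h1]
      _ = x := by rw [← h2]; abel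
  · obtain ⟨y, h1, h2⟩ := (h.mem_graph_iff (u : E) (T u)).mp (T.mem_graph u)
    have h3 : T u - z • (u : E) = -(S : E →L[ℂ] E) y := by
      rw [h2, h1, hSa]
      abel
    rw [h3, ContinuousLinearMap.comp_apply, neg_apply, map_neg, map_neg, map_neg, neg_neg, hl, h1]

lemma eigenvalue_im (h : IsInvCompactAdd T A B) {z : ℂ} {y : E} (hy : y ∈ eigenspace T z)
    (hy0 : y ≠ 0) : (starRingEnd ℂ) z = z := by
  rw [mem_eigenspace_iff_mem_graph] at hy
  have h1 := h.inner_eq hy hy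
  rw [inner_smul_left, inner_smul_right] at h1
  exact mul_right_cancel₀ (inner_self_ne_zero.mpr hy0) h1

lemma eigenspace_eq_bot (h : IsInvCompactAdd T A B) {z : ℂ} (hz : z.im ≠ 0) :
    eigenspace T z = ⊥ := by
  rw [eq_bot_iff]
  intro y hy
  by_contra hy0
  exact hz (Complex.conj_eq_iff_im.mp (h.eigenvalue_im hy hy0))

/-- Otherwise unit eigenvectors would form an orthonormal family indexed by `ℝ`, impossible in a
separable space. A real base point is needed for the resolvent to be symmetric. -/
lemma exists_real_eigenspace_eq_bot [TopologicalSpace.SeparableSpace E]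
    (h : IsInvCompactAdd T A B) : ∃ t : ℝ, eigenspace T t = ⊥ := by
  by_contra! hne
  have hex : ∀ t : ℝ, ∃ y, y ∈ eigenspace T t ∧ ‖y‖ = 1 := fun t => by
    obtain ⟨y, hy, hy0⟩ := Submodule.exists_mem_ne_zero_of_ne_bot (hne t)
    refine ⟨((‖y‖ : ℂ)⁻¹) • y, Submodule.smul_mem _ _ hy, ?_⟩
    have : ‖y‖ ≠ 0 := norm_ne_zero_iff.mpr hy0
    simp [norm_smul, this]
  choose y hy hy1 using hex
  have hon : Orthonormal ℂ y := by
    refine ⟨hy1, fun s t hst => ?_⟩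
    have h1 := h.inner_eq (mem_eigenspace_iff_mem_graph.mp (hy s))
      (mem_eigenspace_iff_mem_graph.mp (hy t))
    rw [inner_smul_left, inner_smul_right, Complex.conj_ofReal] at h1
    by_contra h0
    exact hst (Complex.ofReal_injective (mul_right_cancel₀ h0 h1))
  have := hon.countable
  exact Uncountable.not_countable (α := ℝ) this

lemma resolvent_isSymmetric (h : IsInvCompactAdd T A B) {t : ℝ} {R : E →L[ℂ] E}
    (hR : IsResolventAt T t R) : (R : E →ₗ[ℂ] E).IsSymmetric := by
  intro x y
  have hg : ∀ x, (R x, x + (t : ℂ) • R x) ∈ T.graph := fun x => by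
    rw [hR.mem_graph_iff, add_sub_cancel_right]
  have h1 := h.inner_eq (hg x) (hg y)
  rw [inner_add_left, inner_add_right, inner_smul_left, inner_smul_right,
    Complex.conj_ofReal] at h1
  exact (add_right_cancel h1).symm

lemma mem_spec_iff [CompleteSpace E] (h : IsInvCompactAdd T A B) {z : ℂ} :
    z ∈ spec T ↔ eigenspace T z ≠ ⊥ := by
  constructor
  · intro hz hbot
    obtain ⟨R, hR, -⟩ := h.exists_compact_resolvent hbot
    exact hz ⟨R, hR⟩
  · rintro hne ⟨R, hR⟩
    exact hne hR.eigenspace_self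

theorem hasPurelyDiscreteSpectrum [CompleteSpace E] [TopologicalSpace.SeparableSpace E]
    (h : IsInvCompactAdd T A B) : HasPurelyDiscreteSpectrum T := by
  obtain ⟨t, ht⟩ := h.exists_real_eigenspace_eq_bot
  obtain ⟨R, hR, hRc⟩ := h.exists_compact_resolvent ht
  have hs := h.resolvent_isSymmetric hR
  have hne : ∀ w ∈ spec T, w ≠ t := fun w hw hwt => (h.mem_spec_iff.mp hw) (hwt ▸ ht)
  intro z hz
  refine ⟨fun hacc => ?_, h.mem_spec_iff.mp hz, ?_⟩
  · have hfin : (Metric.ball z 1 ∩ spec T).Finite := by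
      -- The map `w ↦ (w - t)⁻¹` injects the spectrum in the unit ball around `z` into the
      -- eigenvalues of `R` of modulus at least this constant, and there are finitely many of those.
      have hε : (0 : ℝ) < (‖z - t‖ + 1)⁻¹ := by positivity
      refine Set.Finite.of_finite_image (f := fun w : ℂ => (w - t)⁻¹)
        ((finite_eigenvalues_of_compact hRc hs hε).subset ?_) ?_
      · rintro _ ⟨w, ⟨hwb, hw⟩, rfl⟩
        refine ⟨?_, ?_⟩
        · rw [Module.End.hasEigenvalue_iff, ← hR.eigenspace_eq (hne w hw)]
          exact h.mem_spec_iff.mp hw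
        · rw [norm_inv]
          have : 0 < ‖w - t‖ := norm_pos_iff.mpr (sub_ne_zero.mpr (hne w hw))
          refine inv_anti₀ this ?_
          rw [Metric.mem_ball, dist_eq_norm] at hwb
          calc ‖w - t‖ = ‖(w - z) + (z - t)‖ := by ring_nf
            _ ≤ ‖w - z‖ + ‖z - t‖ := norm_add_le _ _
            _ ≤ ‖z - t‖ + 1 := by linarith
      · intro w _ w' _ hww
        exact sub_left_injective (inv_injective hww)
    refine Set.Infinite.of_accPt (x := z) ?_ hfin
    rw [accPt_iff_nhds] at hacc ⊢
    intro U hU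
    obtain ⟨y, hy, hyz⟩ := hacc (U ∩ Metric.ball z 1)
      (inter_mem hU (Metric.ball_mem_nhds z one_pos))
    exact ⟨y, ⟨hy.1.1, hy.1.2, hy.2⟩, hyz⟩
  · rw [hR.eigenspace_eq (hne z hz)]
    exact ContinuousLinearMap.finite_dimensional_eigenspace hRc _
      (inv_ne_zero (sub_ne_zero.mpr (hne z hz)))

/-- An eigenvector of the resolvent at `t` with eigenvalue `w` is one of `T` with eigenvalue `t +
w⁻¹`, which is real by symmetry. -/
theorem exists_hilbertBasis [CompleteSpace E] [TopologicalSpace.SeparableSpace E]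
    (hinf : ¬ FiniteDimensional ℂ E) (h : IsInvCompactAdd T A B) :
    ∃ (f : HilbertBasis ℕ ℂ E) (lam : ℕ → ℝ), ∀ n, f n ∈ eigenspace T (lam n : ℂ) := by
  obtain ⟨t, ht⟩ := h.exists_real_eigenspace_eq_bot
  obtain ⟨R, hR, hRc⟩ := h.exists_compact_resolvent ht
  obtain ⟨f, w, hf⟩ := exists_hilbertBasis_eigenvectors hinf hRc (h.resolvent_isSymmetric hR)
    fun _ => hR.injective
  have hmem : ∀ n, f n ∈ eigenspace T (t + (w n)⁻¹) := fun n => by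
    have h0 : f n ≠ 0 := f.orthonormal.ne_zero n
    have hw : w n ≠ 0 := fun hw => h0 (hR.injective (by rw [hf, hw, zero_smul]))
    rw [hR.mem_eigenspace_iff, hf, add_sub_cancel_left, inv_smul_smul₀ hw]
  refine ⟨f, fun n => (t + (w n)⁻¹ : ℂ).re, fun n => ?_⟩
  rw [Complex.conj_eq_iff_re.mp (h.eigenvalue_im (hmem n) (f.orthonormal.ne_zero n))]
  exact hmem n

end IsInvCompactAdd

/-! ### Absolutely continuous functions and primitives -/

/-- Increments are dominated by those of the real primitive of `‖g‖`, so the same `δ` works. -/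
lemma _root_.MeasureTheory.Integrable.absolutelyContinuousOnInterval_primitive {g : ℝ → ℂ}
    (hg : Integrable g) (l c d : ℝ) :
    AbsolutelyContinuousOnInterval (fun x => ∫ t in l..x, g t) c d := by
  have h := (hg.norm.intervalIntegrable (a := c) (b := d)
    ).absolutelyContinuousOnInterval_intervalIntegral (c := c) left_mem_uIcc
  rw [absolutelyContinuousOnInterval_iff] at h ⊢
  intro ε hε
  obtain ⟨δ, hδ, H⟩ := h ε hε
  refine ⟨δ, hδ, fun E hE hlen => lt_of_le_of_lt (Finset.sum_le_sum fun i _ => ?_) (H E hE hlen)⟩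
  have hi : ∀ x y : ℝ, IntervalIntegrable g volume x y := fun x y => hg.intervalIntegrable
  have hn : ∀ x y : ℝ, IntervalIntegrable (fun t => ‖g t‖) volume x y :=
    fun x y => hg.norm.intervalIntegrable
  rw [dist_comm, dist_comm (∫ t in c..(E.2 i).1, ‖g t‖), dist_eq_norm, Real.dist_eq,
    intervalIntegral.integral_interval_sub_left (hi _ _) (hi _ _),
    intervalIntegral.integral_interval_sub_left (hn _ _) (hn _ _)]
  exact intervalIntegral.norm_integral_le_abs_integral_norm

lemma ACLoc.eq_const_of_ae_hasDerivAt_zero {h : ℝ → ℂ} {l r : ℝ} (hac : ACLoc h l r)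
    (h0 : ∀ᵐ x, x ∈ Ioo l r → HasDerivAt h 0 x) : ∃ C, ∀ x ∈ Ioo l r, h x = C := by
  by_cases hlr : l < r
  · obtain ⟨m, hm1, hm2⟩ := exists_between hlr
    refine ⟨h m, fun x hx => ?_⟩
    have hlo : l < min x m := lt_min hx.1 hm1
    have hhi : max x m < r := max_lt hx.2 hm2
    obtain ⟨C, hC⟩ := (hac _ _ hlo min_le_max hhi).const_of_ae_hasDerivAt_zero (by
      filter_upwards [h0] with y hy hym
      rw [uIcc_of_le min_le_max] at hym
      exact hy ⟨hlo.trans_le hym.1, hym.2.trans_lt hhi⟩)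
    rw [uIcc_of_le min_le_max] at hC
    rw [hC x ⟨min_le_left _ _, le_max_left _ _⟩, hC m ⟨min_le_right _ _, le_max_right _ _⟩]
  · exact ⟨0, fun x hx => absurd (hx.1.trans hx.2) hlr⟩

/-- A locally absolutely continuous function whose derivative agrees almost everywhere with a
continuous function is differentiable everywhere. -/
lemma ACLoc.hasDerivAt_of_ae {h g : ℝ → ℂ} {l r : ℝ} (hac : ACLoc h l r)
    (hg : ContinuousOn g (Ioo l r)) (hd : ∀ᵐ x, x ∈ Ioo l r → HasDerivAt h (g x) x)
    {x : ℝ} (hx : x ∈ Ioo l r) : HasDerivAt h (g x) x := by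
  obtain ⟨c, hc1, hc2⟩ := exists_between hx.1
  obtain ⟨d, hd1, hd2⟩ := exists_between hx.2
  have hcd : c ≤ d := hc2.le.trans hd1.le
  have hsub : Icc c d ⊆ Ioo l r := fun y hy => ⟨hc1.trans_le hy.1, hy.2.trans_lt hd2⟩
  -- The constant extension of `g` has a global `C¹` primitive, and `h` minus that primitive is
  -- constant on `[c, d]`.
  set G : ℝ → ℂ := IccExtend hcd ((Icc c d).domRestrict g) with hG
  have hGc : Continuous G :=
    (continuousOn_iff_continuous_domRestrict.mp (hg.mono hsub)).Icc_extend'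
  have hGeq : ∀ y ∈ Icc c d, G y = g y := fun y hy => by
    rw [hG, IccExtend_of_mem hcd _ hy]; rfl
  have hΦd : ∀ y, HasDerivAt (fun y => ∫ t in c..y, G t) (G y) y := fun y =>
    intervalIntegral.integral_hasDerivAt_right (hGc.intervalIntegrable c y)
      (hGc.stronglyMeasurableAtFilter _ _) hGc.continuousAt
  have hΦ1 : ContDiff ℝ 1 (fun y => ∫ t in c..y, G t) := by
    rw [contDiff_one_iff_deriv]
    refine ⟨fun y => (hΦd y).differentiableAt, ?_⟩
    rw [funext fun y => (hΦd y).deriv]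
    exact hGc
  obtain ⟨C, hC⟩ := ((hac c d hc1 hcd hd2).sub
    hΦ1.contDiffOn.absolutelyContinuousOnInterval).const_of_ae_hasDerivAt_zero (by
    filter_upwards [hd] with y hy hym
    rw [uIcc_of_le hcd] at hym
    have := (hy (hsub hym)).sub (hΦd y)
    rwa [hGeq y hym, sub_self] at this)
  rw [uIcc_of_le hcd] at hC
  have heq : h =ᶠ[𝓝 x] fun y => C + ∫ t in c..y, G t := by
    filter_upwards [Icc_mem_nhds hc2 hd1] with y hy
    rw [← hC y hy]; simp
  rw [← hGeq x ⟨hc2.le, hd1.le⟩]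
  exact ((hΦd x).const_add C).congr_of_eventuallyEq heq

variable (a : Fin 4 → ℝ)

/-- The primitive `x ↦ ∫_{a₂}^x f` of the restriction of `f` to `(a₂, a₄)`. -/
def prim (f : ℝ → ℂ) (x : ℝ) : ℂ := ∫ t in (a 1)..x, (Ioo (a 1) (a 3)).indicator f t

variable {a} {f g : ℝ → ℂ}

lemma integrable_indicator_of_integrable (hf : Integrable f (μ a)) :
    Integrable ((Ioo (a 1) (a 3)).indicator f) :=
  (integrable_indicator_iff measurableSet_Ioo).mpr hf

lemma prim_left : prim a f (a 1) = 0 := intervalIntegral.integral_same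

lemma prim_right (ha : StrictMono a) : prim a f (a 3) = ∫ x, f x ∂(μ a) := by
  have h13 : a 1 < a 3 := ha (by decide)
  rw [prim, intervalIntegral.integral_of_le h13.le, integral_Ioc_eq_integral_Ioo,
    setIntegral_indicator measurableSet_Ioo, inter_self]

lemma prim_congr (h : f =ᵐ[μ a] g) : prim a f = prim a g := by
  funext x
  refine intervalIntegral.integral_congr_ae ?_
  have h' := (ae_restrict_iff' measurableSet_Ioo).mp h
  filter_upwards [h'] with y hy _
  by_cases hm : y ∈ Ioo (a 1) (a 3)
  · rw [indicator_of_mem hm, indicator_of_mem hm, hy hm]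
  · rw [indicator_of_notMem hm, indicator_of_notMem hm]

lemma continuous_prim (hf : Integrable f (μ a)) : Continuous (prim a f) :=
  (integrable_indicator_of_integrable hf).continuous_primitive _

lemma absolutelyContinuousOnInterval_prim (hf : Integrable f (μ a)) (c d : ℝ) :
    AbsolutelyContinuousOnInterval (prim a f) c d :=
  (integrable_indicator_of_integrable hf).absolutelyContinuousOnInterval_primitive _ _ _

lemma hasDerivAt_prim (hf : Integrable f (μ a)) :
    ∀ᵐ x, x ∈ Ioo (a 1) (a 3) → HasDerivAt (prim a f) (f x) x := by
  filter_upwards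
    [LocallyIntegrable.ae_hasDerivAt_integral
      (integrable_indicator_of_integrable hf).locallyIntegrable] with x hx hm
  have := hx (a 1)
  rwa [indicator_of_mem hm] at this

lemma norm_prim_le (hf : Integrable f (μ a)) {x : ℝ} (hx : a 1 ≤ x) :
    ‖prim a f x‖ ≤ ∫ x, ‖f x‖ ∂(μ a) := by
  have hi := integrable_indicator_of_integrable hf
  rw [prim, intervalIntegral.integral_of_le hx]
  refine (norm_integral_le_integral_norm _).trans ?_
  refine (setIntegral_le_integral hi.norm (Eventually.of_forall fun _ => norm_nonneg _)).trans ?_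
  simp_rw [norm_indicator_eq_indicator_norm]
  rw [integral_indicator measurableSet_Ioo]

lemma integrable_mul_prim (hf : Integrable f (μ a)) (hg : Integrable g (μ a)) :
    Integrable (fun x => f x * prim a g x) (μ a) := by
  refine hf.mul_bdd (c := ∫ x, ‖g x‖ ∂(μ a))
    (continuous_prim hg).aestronglyMeasurable ?_
  rw [ae_restrict_iff' measurableSet_Ioo]
  exact Eventually.of_forall fun x hx => norm_prim_le hg hx.1.le

/-- Integration by parts. -/
lemma integral_mul_prim_add (ha : StrictMono a) (hf : Integrable f (μ a))
    (hg : Integrable g (μ a)) :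
    (∫ x, f x * prim a g x ∂(μ a)) + ∫ x, g x * prim a f x ∂(μ a)
      = (∫ x, f x ∂(μ a)) * ∫ x, g x ∂(μ a) := by
  have hfg := integrable_mul_prim hf hg
  have hgf := integrable_mul_prim hg hf
  have h13 : a 1 < a 3 := ha (by decide)
  rw [← integral_add hfg hgf, ← prim_right ha, ← prim_right ha, ← prim_right ha]
  set s : ℝ → ℂ := fun x => f x * prim a g x + g x * prim a f x
  have hs : Integrable s (μ a) := hfg.add hgf
  -- The product of the two primitives minus the primitive of `s` has derivative zero almost
  -- everywhere. It vanishes at `a 1`, hence also at `a 3`.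
  obtain ⟨C, hC⟩ := (((absolutelyContinuousOnInterval_prim hf (a 1) (a 3)).fun_smul
    (absolutelyContinuousOnInterval_prim hg (a 1) (a 3))).fun_sub
    (absolutelyContinuousOnInterval_prim hs (a 1) (a 3))).const_of_ae_hasDerivAt_zero (by
      have h1 : ∀ᵐ x : ℝ, x ≠ a 1 := by simp [ae_iff]
      have h3 : ∀ᵐ x : ℝ, x ≠ a 3 := by simp [ae_iff]
      filter_upwards [hasDerivAt_prim hf, hasDerivAt_prim hg, hasDerivAt_prim hs, h1, h3]
        with x d1 d2 d3 h1 h3 hx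
      rw [uIcc_of_le h13.le] at hx
      have hm : x ∈ Ioo (a 1) (a 3) := ⟨lt_of_le_of_ne hx.1 h1.symm, lt_of_le_of_ne hx.2 h3⟩
      have e : f x * prim a g x + prim a f x * g x - s x = 0 := by
        simp only [s]
        ring
      have d := ((d1 hm).mul (d2 hm)).sub (d3 hm)
      rw [e] at d
      exact d)
  have e1 := hC (a 1) left_mem_uIcc
  have e3 := hC (a 3) right_mem_uIcc
  simp only [prim_left, smul_eq_mul, mul_zero, sub_zero] at e1
  rw [← e1, sub_eq_zero] at e3
  exact e3.symm

/-! ### The function `v` -/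

/-- The coefficients of `v` are the Lagrange nodal weights. The partial fraction expansion of `1/P`
is the barycentric form of interpolating the constant `1`. -/
lemma hasDerivAt_v (ha : StrictMono a) {x : ℝ} (hx : ∀ i, x ≠ a i) :
    HasDerivAt (v a) ((P a x : ℂ)⁻¹) x := by
  have h1 : ∀ i, HasDerivAt (fun y => Real.log |y - a i|) (x - a i)⁻¹ x := fun i => by
    simp_rw [Real.log_abs]
    simpa using ((hasDerivAt_id x).sub_const (a i)).log (sub_ne_zero.mpr (hx i))
  have h2 : HasDerivAt (fun y => ∑ i, (∏ j ∈ Finset.univ.erase i, 1 / (a i - a j)) *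
      Real.log |y - a i|)
      (∑ i, (∏ j ∈ Finset.univ.erase i, 1 / (a i - a j)) * (x - a i)⁻¹) x :=
    HasDerivAt.fun_sum fun i _ => (h1 i).const_mul _
  have h3 : ∑ i, (∏ j ∈ Finset.univ.erase i, 1 / (a i - a j)) * (x - a i)⁻¹ = (P a x)⁻¹ := by
    have hL := Lagrange.eval_interpolate_not_at_node (s := Finset.univ) (v := a) 1
      (x := x) fun i _ => hx i
    rw [Lagrange.interpolate_one ha.injective.injOn Finset.univ_nonempty, Lagrange.eval_nodal,
      Polynomial.eval_one] at hL
    refine eq_inv_of_mul_eq_one_right ?_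
    rw [P]
    refine Eq.trans ?_ hL.symm
    simp [Lagrange.nodalWeight]
  rw [h3] at h2
  have := h2.ofReal_comp
  rwa [Complex.ofReal_inv] at this

lemma conj_v (x : ℝ) : (starRingEnd ℂ) (v a x) = v a x := Complex.conj_ofReal _

lemma intervalIntegrable_log_sq (p q : ℝ) :
    IntervalIntegrable (fun x => Real.log x ^ 2) volume p q := by
  refine intervalIntegrable_of_even (fun x => by rw [Real.log_neg_eq_log]) (fun x hx => ?_)
    (by simp) (by simp)
  rw [intervalIntegrable_iff_integrableOn_Ioc_of_le hx.le]
  -- This is the antiderivative `x log² x - 2 x log x + 2 x`. Its first term is written as `4 (√x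
  -- log √x)²` so that continuity at `0` follows from that of `x log x`.
  refine intervalIntegral.integrableOn_deriv_of_nonneg
    (g := fun x => 4 * (√x * Real.log √x) ^ 2 - 2 * (x * Real.log x) + 2 * x) ?_ ?_
    fun y _ => sq_nonneg _
  · have := Real.continuous_mul_log
    have h2 : Continuous fun x => √x * Real.log √x := this.comp Real.continuous_sqrt
    fun_prop
  · intro y hy
    have hl := Real.hasDerivAt_log hy.1.ne'
    have hm := Real.hasDerivAt_mul_log hy.1.ne'
    have h := ((hm.mul hl).sub (hm.const_mul 2)).add ((hasDerivAt_id y).const_mul 2)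
    have he : (Real.log y + 1) * Real.log y + y * Real.log y * y⁻¹ - 2 * (Real.log y + 1) + 2 * 1
        = Real.log y ^ 2 := by
      field_simp [hy.1.ne']
      ring
    rw [he] at h
    refine h.congr_of_eventuallyEq ?_
    filter_upwards [Ioi_mem_nhds hy.1] with z hz
    have hz' : (0 : ℝ) ≤ z := le_of_lt hz
    simp only [Pi.add_apply, Pi.sub_apply, Pi.mul_apply, id]
    rw [Real.log_sqrt hz', mul_pow, Real.sq_sqrt hz']
    ring

lemma memLp_v (ha : StrictMono a) : MemLp (v a) 2 (μ a) := by
  have h13 : a 1 < a 3 := ha (by decide)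
  have hlog : ∀ i, MemLp (fun y => Real.log |y - a i|) 2 (μ a) := fun i => by
    have hm : AEStronglyMeasurable (fun y => Real.log |y - a i|) (μ a) := by
      refine Measurable.aestronglyMeasurable ?_
      fun_prop
    rw [memLp_two_iff_integrable_sq hm]
    have := (intervalIntegrable_log_sq (a 1 - a i) (a 3 - a i)).comp_sub_right (a i)
    rw [sub_add_cancel, sub_add_cancel, intervalIntegrable_iff_integrableOn_Ioo_of_le h13.le]
      at this
    simp_rw [Real.log_abs]
    exact this
  have h := memLp_finsetSum (μ := μ a) (p := 2) Finset.univ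
    (f := fun i y => (∏ j ∈ Finset.univ.erase i, 1 / (a i - a j)) * Real.log |y - a i|)
    fun i _ => (hlog i).const_mul _
  exact h.ofReal

lemma lagrange_u (ψ : ℝ → ℂ) (x : ℝ) : lagrange a ψ u x = -quasi a ψ x := by
  simp [lagrange, u, quasi]

/-- Since `v` is real and `P v' = 1`, the bracket with `v` is `ψ` with its logarithmic part removed.
-/
lemma lagrange_v (ha : StrictMono a) (ψ : ℝ → ℂ) {x : ℝ} (hx : ∀ i, x ≠ a i) :
    lagrange a ψ (v a) x = ψ x - v a x * quasi a ψ x := by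
  have h : quasi a (fun y => (starRingEnd ℂ) (v a y)) x = 1 := by
    simp_rw [conj_v]
    rw [quasi, (hasDerivAt_v ha hx).deriv, mul_inv_cancel₀]
    exact_mod_cast P_ne_zero hx
  rw [lagrange, h, conj_v, mul_one]

/-! ### Solutions of `(P ψ')' = f` -/

variable {l r : ℝ}

variable (a) in
/-- The solution `x ↦ c + ∫_{a₂}^x (v(x) - v(t)) f(t) dt` of `(P ψ')' = f`. -/
def sol (c : ℂ) (f : ℝ → ℂ) (x : ℝ) : ℂ :=
  c + (v a x * prim a f x - prim a (fun t => v a t * f t) x)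

lemma integrable_of_memLp (hf : MemLp f 2 (μ a)) : Integrable f (μ a) :=
  hf.integrable one_le_two

lemma integrable_v_mul (ha : StrictMono a) (hf : MemLp f 2 (μ a)) :
    Integrable (fun t => v a t * f t) (μ a) :=
  (memLp_v ha).integrable_mul hf

lemma acLoc_v (hn : ∀ x ∈ Ioo l r, ∀ i, x ≠ a i) : ACLoc (v a) l r := by
  intro c d hc hcd hd
  refine ContDiffOn.absolutelyContinuousOnInterval fun x hx => ContDiffAt.contDiffWithinAt ?_
  rw [uIcc_of_le hcd] at hx
  have hx' : x ∈ Ioo l r := ⟨hc.trans_le hx.1, hx.2.trans_lt hd⟩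
  have h : ContDiffAt ℝ 1 (fun y => ∑ i, (∏ j ∈ Finset.univ.erase i, 1 / (a i - a j)) *
      Real.log |y - a i|) x := by
    simp_rw [Real.log_abs]
    exact ContDiffAt.sum fun i _ => contDiffAt_const.mul
      ((contDiffAt_id.sub contDiffAt_const).log (sub_ne_zero.mpr (hn x hx' i)))
  exact Complex.ofRealCLM.contDiff.contDiffAt.comp x h

lemma acLoc_prim (hf : Integrable f (μ a)) : ACLoc (prim a f) l r :=
  fun c d _ _ _ => absolutelyContinuousOnInterval_prim hf c d

lemma acLoc_sol (ha : StrictMono a) (hn : ∀ x ∈ Ioo l r, ∀ i, x ≠ a i) (hf : MemLp f 2 (μ a))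
    (c : ℂ) : ACLoc (sol a c f) l r := fun p q hp hpq hq =>
  (contDiff_const (c := c)).contDiffOn.absolutelyContinuousOnInterval.fun_add
    (((acLoc_v hn p q hp hpq hq).fun_smul
      (absolutelyContinuousOnInterval_prim (integrable_of_memLp hf) p q)).fun_sub
      (absolutelyContinuousOnInterval_prim (integrable_v_mul ha hf) p q))

/-- The terms `v f` cancel in the product rule, which holds only almost everywhere. What remains is
continuous, so the formula extends to every point. -/
lemma hasDerivAt_sol (ha : StrictMono a) (hI : Ioo l r ⊆ Ioo (a 1) (a 3))
    (hn : ∀ x ∈ Ioo l r, ∀ i, x ≠ a i) (hf : MemLp f 2 (μ a)) (c : ℂ) {x : ℝ}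
    (hx : x ∈ Ioo l r) : HasDerivAt (sol a c f) ((P a x : ℂ)⁻¹ * prim a f x) x := by
  refine (acLoc_sol ha hn hf c).hasDerivAt_of_ae (g := fun x => (P a x : ℂ)⁻¹ * prim a f x) ?_ ?_ hx
  · refine ContinuousOn.mul (ContinuousOn.inv₀ ?_ fun y hy => ?_)
      (continuous_prim (integrable_of_memLp hf)).continuousOn
    · exact (Complex.continuous_ofReal.comp (continuous_P a)).continuousOn
    · exact_mod_cast P_ne_zero (hn y hy)
  · filter_upwards [hasDerivAt_prim (integrable_of_memLp hf),
      hasDerivAt_prim (integrable_v_mul ha hf)] with y h1 h2 hy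
    have h := (((hasDerivAt_v ha (hn y hy)).mul (h1 (hI hy))).sub (h2 (hI hy))).const_add c
    rw [add_sub_cancel_right] at h
    exact h

lemma quasi_sol (ha : StrictMono a) (hI : Ioo l r ⊆ Ioo (a 1) (a 3))
    (hn : ∀ x ∈ Ioo l r, ∀ i, x ≠ a i) (hf : MemLp f 2 (μ a)) (c : ℂ) {x : ℝ}
    (hx : x ∈ Ioo l r) : quasi a (sol a c f) x = prim a f x := by
  rw [quasi, (hasDerivAt_sol ha hI hn hf c hx).deriv, mul_inv_cancel_left₀]
  exact_mod_cast P_ne_zero (hn x hx)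

lemma L_sol (ha : StrictMono a) (hI : Ioo l r ⊆ Ioo (a 1) (a 3))
    (hn : ∀ x ∈ Ioo l r, ∀ i, x ≠ a i) (hf : MemLp f 2 (μ a)) (c : ℂ) :
    ∀ᵐ x, x ∈ Ioo l r →
      L a (sol a c f) x = f x + 2 * ((x - σ a : ℝ) : ℂ) ^ 2 * sol a c f x := by
  filter_upwards [hasDerivAt_prim (integrable_of_memLp hf)] with x h1 hx
  have : quasi a (sol a c f) =ᶠ[𝓝 x] prim a f := by
    filter_upwards [Ioo_mem_nhds hx.1 hx.2] with y hy using quasi_sol ha hI hn hf c hy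
  rw [L, this.deriv_eq, (h1 (hI hx)).deriv]

lemma bound_prim (hf : Integrable f (μ a)) :
    ∀ᵐ x ∂(μ a), ‖prim a f x‖ ≤ ∫ x, ‖f x‖ ∂(μ a) := by
  rw [ae_restrict_iff' measurableSet_Ioo]
  exact Eventually.of_forall fun x hx => norm_prim_le hf hx.1.le

lemma memLp_sol (ha : StrictMono a) (hf : MemLp f 2 (μ a)) (c : ℂ) :
    MemLp (sol a c f) 2 (μ a) := by
  have hf1 := integrable_of_memLp hf
  have hf2 := integrable_v_mul ha hf
  refine (memLp_const c).add (MemLp.sub ?_ ?_)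
  · refine (memLp_v ha).of_le_mul (c := ∫ x, ‖f x‖ ∂(μ a))
      ((memLp_v ha).aestronglyMeasurable.mul (continuous_prim hf1).aestronglyMeasurable) ?_
    filter_upwards [bound_prim hf1] with x hx
    rw [norm_mul, mul_comm]
    gcongr
  · exact MemLp.of_bound (continuous_prim hf2).aestronglyMeasurable _ (bound_prim hf2)

lemma memLp_potential_mul {ψ : ℝ → ℂ} {ν : Measure ℝ} (hν : ∀ᵐ x ∂ν, x ∈ Ioo l r)
    (hψ : MemLp ψ 2 ν) : MemLp (fun x => 2 * ((x - σ a : ℝ) : ℂ) ^ 2 * ψ x) 2 ν := by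
  have hc : Continuous fun x : ℝ => 2 * ((x - σ a : ℝ) : ℂ) ^ 2 := by fun_prop
  obtain ⟨C, hC⟩ := (isCompact_Icc (a := l) (b := r)).exists_bound_of_continuousOn hc.continuousOn
  refine hψ.of_le_mul (c := C) (hc.aestronglyMeasurable.mul hψ.aestronglyMeasurable) ?_
  filter_upwards [hν] with x hx
  rw [norm_mul]
  exact mul_le_mul_of_nonneg_right (hC x (Ioo_subset_Icc_self hx)) (norm_nonneg _)

lemma memDmaxOn_sol (ha : StrictMono a) (hI : Ioo l r ⊆ Ioo (a 1) (a 3))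
    (hn : ∀ x ∈ Ioo l r, ∀ i, x ≠ a i) (hf : MemLp f 2 (μ a)) (c : ℂ) :
    MemDmaxOn a l r (sol a c f) := by
  have hle := Measure.restrict_mono (μ := (volume : Measure ℝ)) hI le_rfl
  have hs := (memLp_sol ha hf c).mono_measure hle
  refine ⟨acLoc_sol ha hn hf c, (acLoc_prim (integrable_of_memLp hf)).congr
    fun x hx => (quasi_sol ha hI hn hf c hx).symm, hs, ?_⟩
  refine (memLp_congr_ae ((ae_restrict_iff' measurableSet_Ioo).mpr (L_sol ha hI hn hf c))).mpr ?_
  exact (hf.mono_measure hle).add (memLp_potential_mul (ae_restrict_mem measurableSet_Ioo) hs)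

lemma Ioo_left_subset (ha : StrictMono a) : Ioo (a 1) (a 2) ⊆ Ioo (a 1) (a 3) :=
  Ioo_subset_Ioo_right (ha (by decide : (2 : Fin 4) < 3)).le

lemma Ioo_right_subset (ha : StrictMono a) : Ioo (a 2) (a 3) ⊆ Ioo (a 1) (a 3) :=
  Ioo_subset_Ioo_left (ha (by decide : (1 : Fin 4) < 2)).le

lemma ne_node_of_P_ne_zero {x : ℝ} (h : P a x ≠ 0) (i : Fin 4) : x ≠ a i := by
  rintro rfl
  exact h (Finset.prod_eq_zero (Finset.mem_univ i) (sub_self _))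

lemma ne_node_left (ha : StrictMono a) : ∀ x ∈ Ioo (a 1) (a 2), ∀ i, x ≠ a i :=
  fun _ hx => ne_node_of_P_ne_zero (P_ne_zero_left ha hx)

lemma ne_node_right (ha : StrictMono a) : ∀ x ∈ Ioo (a 2) (a 3), ∀ i, x ≠ a i :=
  fun _ hx => ne_node_of_P_ne_zero (P_ne_zero_right ha hx)

/-- The brackets with `u` and `v` are `-prim f` and `c - prim (v f)`, both continuous across `a₃`.
Only the condition at `a₄` uses the vanishing mean. -/
theorem memDomain_sol (ha : StrictMono a) (hf : MemLp f 2 (μ a)) (h0 : ∫ x, f x ∂(μ a) = 0)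
    (c : ℂ) : MemDomain a (sol a c f) := by
  have hn : ∀ x ∈ Ioo (a 1) (a 2) ∪ Ioo (a 2) (a 3), ∀ i, x ≠ a i := fun x hx =>
    hx.elim (ne_node_left ha x) (ne_node_right ha x)
  have hq : ∀ x ∈ Ioo (a 1) (a 2) ∪ Ioo (a 2) (a 3), quasi a (sol a c f) x = prim a f x := by
    rintro x (hx | hx)
    · exact quasi_sol ha (Ioo_left_subset ha) (ne_node_left ha) hf c hx
    · exact quasi_sol ha (Ioo_right_subset ha) (ne_node_right ha) hf c hx
  obtain ⟨e1, e2, e3, e4⟩ := eventually_mem ha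
  have hu : ∀ {F : Filter ℝ} {p : ℝ}, F ≤ 𝓝 p →
      (∀ᶠ x in F, x ∈ Ioo (a 1) (a 2) ∪ Ioo (a 2) (a 3)) →
      Tendsto (lagrange a (sol a c f) u) F (𝓝 (-prim a f p)) := fun {F p} hF he => by
    refine Tendsto.congr' ?_
      ((continuous_prim (integrable_of_memLp hf)).neg.continuousAt.tendsto.mono_left hF)
    filter_upwards [he] with x hx
    rw [lagrange_u, hq x hx, Pi.neg_apply]
  have hv : ∀ {F : Filter ℝ} {p : ℝ}, F ≤ 𝓝 p →
      (∀ᶠ x in F, x ∈ Ioo (a 1) (a 2) ∪ Ioo (a 2) (a 3)) →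
      Tendsto (lagrange a (sol a c f) (v a)) F (𝓝 (c - prim a (fun t => v a t * f t) p)) :=
    fun {F p} hF he => by
    refine Tendsto.congr' ?_
      ((continuous_const.sub (continuous_prim (integrable_v_mul ha hf))
        ).continuousAt.tendsto.mono_left hF)
    filter_upwards [he] with x hx
    rw [lagrange_v ha _ (hn x hx), hq x hx, sol, Pi.sub_apply]
    ring
  refine ⟨⟨memDmaxOn_sol ha (Ioo_left_subset ha) (ne_node_left ha) hf c,
    memDmaxOn_sol ha (Ioo_right_subset ha) (ne_node_right ha) hf c⟩, ?_, ?_,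
    ⟨_, hu nhdsWithin_le_nhds e2, hu nhdsWithin_le_nhds e3⟩,
    ⟨_, hv nhdsWithin_le_nhds e2, hv nhdsWithin_le_nhds e3⟩⟩
  · simpa [prim_left] using hu nhdsWithin_le_nhds e1
  · simpa [prim_right ha, h0] using hu nhdsWithin_le_nhds e4

theorem L_sol_ae (ha : StrictMono a) (hf : MemLp f 2 (μ a)) (c : ℂ) :
    L a (sol a c f) =ᵐ[μ a] fun x => f x + 2 * ((x - σ a : ℝ) : ℂ) ^ 2 * sol a c f x :=
  ae_of_ae (L_sol ha (Ioo_left_subset ha) (ne_node_left ha) hf c)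
    (L_sol ha (Ioo_right_subset ha) (ne_node_right ha) hf c)

/-! ### Every element of the domain is such a solution -/

lemma memLp_of_left_right {g : ℝ → ℂ}
    (h1 : MemLp g 2 (volume.restrict (Ioo (a 1) (a 2))))
    (h2 : MemLp g 2 (volume.restrict (Ioo (a 2) (a 3)))) : MemLp g 2 (μ a) := by
  rw [← memLp_indicator_iff_restrict measurableSet_Ioo] at h1 h2
  refine (memLp_congr_ae ?_).mp ((h1.add h2).restrict (Ioo (a 1) (a 3)))
  refine ae_of_ae (Eventually.of_forall fun x hx => ?_) (Eventually.of_forall fun x hx => ?_)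
  · rw [Pi.add_apply, indicator_of_mem hx, indicator_of_notMem, add_zero]
    exact fun h => lt_asymm h.1 hx.2
  · rw [Pi.add_apply, indicator_of_mem hx, indicator_of_notMem, zero_add]
    exact fun h => lt_asymm h.2 hx.1

/-- Variation of constants: `(ψ - v P ψ')' = -v (P ψ')'` because `v' = 1/P`. -/
lemma MemDmaxOn.exists_eq_prim {ψ : ℝ → ℂ} (hψ : MemDmaxOn a l r ψ)
    (ha : StrictMono a) (hI : Ioo l r ⊆ Ioo (a 1) (a 3)) (hn : ∀ x ∈ Ioo l r, ∀ i, x ≠ a i)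
    (hf : MemLp f 2 (μ a)) (hfd : ∀ x, f x = deriv (quasi a ψ) x) :
    (∃ C, ∀ x ∈ Ioo l r, quasi a ψ x = C + prim a f x) ∧
      ∃ D, ∀ x ∈ Ioo l r, ψ x - v a x * quasi a ψ x = D - prim a (fun t => v a t * f t) x := by
  have hf1 := integrable_of_memLp hf
  have hf2 := integrable_v_mul ha hf
  constructor
  · obtain ⟨C, hC⟩ := ACLoc.eq_const_of_ae_hasDerivAt_zero (l := l) (r := r)
      (h := fun x => quasi a ψ x - prim a f x)
      (fun c d h1 h2 h3 => (hψ.ac_quasi c d h1 h2 h3).fun_sub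
        (absolutelyContinuousOnInterval_prim hf1 c d)) (by
      filter_upwards [hψ.ac_quasi.ae_differentiableAt, hasDerivAt_prim hf1] with x h1 h2 hx
      have h := (h1 hx).hasDerivAt.sub (h2 (hI hx))
      rw [hfd, sub_self] at h
      exact h)
    exact ⟨C, fun x hx => by rw [← hC x hx, sub_add_cancel]⟩
  · obtain ⟨D, hD⟩ := ACLoc.eq_const_of_ae_hasDerivAt_zero (l := l) (r := r)
      (h := fun x => ψ x - v a x • quasi a ψ x + prim a (fun t => v a t * f t) x)
      (fun c d h1 h2 h3 => ((hψ.ac c d h1 h2 h3).fun_sub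
        ((acLoc_v hn c d h1 h2 h3).fun_smul (hψ.ac_quasi c d h1 h2 h3))).fun_add
        (absolutelyContinuousOnInterval_prim hf2 c d)) (by
      filter_upwards [hψ.ac_quasi.ae_differentiableAt, hasDerivAt_prim hf2] with x h1 h2 hx
      have hP : (P a x : ℂ) ≠ 0 := by exact_mod_cast P_ne_zero (hn x hx)
      have hψd := (hψ.differentiableAt (fun y hy => P_ne_zero (hn y hy)) hx).hasDerivAt
      have h := (hψd.sub ((hasDerivAt_v ha (hn x hx)).mul (h1 hx).hasDerivAt)).add (h2 (hI hx))
      have e : deriv ψ x - ((P a x : ℂ)⁻¹ * quasi a ψ x + v a x * deriv (quasi a ψ) x)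
          + v a x * f x = 0 := by
        rw [hfd, quasi, inv_mul_cancel_left₀ hP]
        ring
      rw [e] at h
      exact h)
    exact ⟨D, fun x hx => by rw [← hD x hx, smul_eq_mul]; ring⟩

/-- The bracket with `u` gives `C₁ = 0` at `a₂`, then `C₂ = C₁` at `a₃`, then mean zero at `a₄`. The
bracket with `v` gives `D₂ = D₁` at `a₃`. -/
theorem MemDomain.exists_eq_sol (ha : StrictMono a) {ψ : ℝ → ℂ} (hψ : MemDomain a ψ) :
    ∃ (f : ℝ → ℂ) (c : ℂ), MemLp f 2 (μ a) ∧ ∫ x, f x ∂(μ a) = 0 ∧ ψ =ᵐ[μ a] sol a c f := by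
  have h12 : a 1 < a 2 := ha (by decide)
  have h23 : a 2 < a 3 := ha (by decide)
  set f : ℝ → ℂ := deriv (quasi a ψ) with hfdef
  have hfeq : f = L a ψ - fun x => 2 * ((x - σ a : ℝ) : ℂ) ^ 2 * ψ x := by
    funext x
    simp [L, f]
  have hpart : ∀ {l r : ℝ}, MemDmaxOn a l r ψ → MemLp f 2 (volume.restrict (Ioo l r)) :=
    fun {l r} h => by
      rw [hfeq]
      exact h.memLp_L.sub (memLp_potential_mul (ae_restrict_mem measurableSet_Ioo) h.memLp)
  have hf : MemLp f 2 (μ a) := memLp_of_left_right (hpart hψ.dmax.left) (hpart hψ.dmax.right)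
  have hF := continuous_prim (integrable_of_memLp hf)
  have hW := continuous_prim (integrable_v_mul ha hf)
  obtain ⟨⟨C₁, hC₁⟩, D₁, hD₁⟩ := hψ.dmax.left.exists_eq_prim ha (Ioo_left_subset ha)
    (ne_node_left ha) hf fun _ => rfl
  obtain ⟨⟨C₂, hC₂⟩, D₂, hD₂⟩ := hψ.dmax.right.exists_eq_prim ha (Ioo_right_subset ha)
    (ne_node_right ha) hf fun _ => rfl
  have hu : ∀ {s : Set ℝ} {p l r : ℝ} {C : ℂ}, Ioo l r ∈ 𝓝[s] p →
      (∀ x ∈ Ioo l r, quasi a ψ x = C + prim a f x) →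
      Tendsto (lagrange a ψ u) (𝓝[s] p) (𝓝 (-(C + prim a f p))) := fun {s p l r C} hs hC => by
    refine Tendsto.congr' ?_
      ((continuous_const.add hF).neg.continuousAt.tendsto.mono_left nhdsWithin_le_nhds)
    filter_upwards [hs] with x hx
    rw [lagrange_u, hC x hx, Pi.neg_apply, Pi.add_apply]
  have hv : ∀ {s : Set ℝ} {p l r : ℝ} {D : ℂ}, Ioo l r ∈ 𝓝[s] p →
      (∀ x ∈ Ioo l r, ∀ i, x ≠ a i) →
      (∀ x ∈ Ioo l r, ψ x - v a x * quasi a ψ x = D - prim a (fun t => v a t * f t) x) →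
      Tendsto (lagrange a ψ (v a)) (𝓝[s] p) (𝓝 (D - prim a (fun t => v a t * f t) p)) :=
    fun {s p l r D} hs hn hD => by
    refine Tendsto.congr' ?_
      ((continuous_const.sub hW).continuousAt.tendsto.mono_left nhdsWithin_le_nhds)
    filter_upwards [hs] with x hx
    rw [lagrange_v ha _ (hn x hx), hD x hx, Pi.sub_apply]
  have hC₁0 : C₁ = 0 := by
    have := tendsto_nhds_unique (hu (Ioo_mem_nhdsGT h12) hC₁) hψ.bc_left
    simpa [prim_left] using this
  have hC₂0 : C₂ = 0 := by
    obtain ⟨t, h1, h2⟩ := hψ.tc_u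
    have e1 := tendsto_nhds_unique (hu (Ioo_mem_nhdsLT h12) hC₁) h1
    have e2 := tendsto_nhds_unique (hu (Ioo_mem_nhdsGT h23) hC₂) h2
    rw [← e1, hC₁0, zero_add, neg_inj, add_eq_right] at e2
    exact e2
  have hD : D₂ = D₁ := by
    obtain ⟨t, h1, h2⟩ := hψ.tc_v
    have e1 := tendsto_nhds_unique (hv (Ioo_mem_nhdsLT h12) (ne_node_left ha) hD₁) h1
    have e2 := tendsto_nhds_unique (hv (Ioo_mem_nhdsGT h23) (ne_node_right ha) hD₂) h2
    exact sub_left_injective (e2.trans e1.symm)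
  refine ⟨f, D₁, hf, ?_, ?_⟩
  · have := tendsto_nhds_unique (hu (Ioo_mem_nhdsLT h23) hC₂) hψ.bc_right
    rwa [hC₂0, zero_add, neg_eq_zero, prim_right ha] at this
  · refine ae_of_ae (Eventually.of_forall fun x hx => ?_) (Eventually.of_forall fun x hx => ?_)
    · have := hD₁ x hx
      rw [hC₁ x hx, hC₁0, zero_add] at this
      rw [sol]
      linear_combination this
    · have := hD₂ x hx
      rw [hC₂ x hx, hC₂0, zero_add, hD] at this
      rw [sol]
      linear_combination this

/-! ### Compactness of integral operators with a continuous kernel -/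

section Kernel

variable {E X : Type*} [NormedAddCommGroup E] [InnerProductSpace ℂ E] [TopologicalSpace X]
  [CompactSpace X]

/-- The operator `f ↦ (x ↦ ⟪k x, f⟫)`. -/
def kernelOp (k : C(X, E)) : E →L[ℂ] (X →ᵇ ℂ) :=
  LinearMap.mkContinuous
    { toFun := fun f => BoundedContinuousFunction.mkOfCompact
        ⟨fun x => ⟪k x, f⟫_ℂ, k.continuous.inner continuous_const⟩
      map_add' := fun f g => by ext x; exact inner_add_right _ _ _
      map_smul' := fun c f => by ext x; exact inner_smul_right _ _ _ }
    ‖k‖ (fun f => (BoundedContinuousFunction.norm_le (by positivity)).mpr fun x =>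
      (norm_inner_le_norm _ _).trans
        (mul_le_mul_of_nonneg_right (k.norm_coe_le_norm x) (norm_nonneg _)))

lemma kernelOp_apply (k : C(X, E)) (f : E) (x : X) : kernelOp k f x = ⟪k x, f⟫_ℂ := rfl

/-- By Cauchy–Schwarz the image of the unit ball is bounded by `‖k‖` and inherits the modulus of
continuity of `k`, so Arzelà–Ascoli applies. -/
lemma isCompactOperator_kernelOp (k : C(X, E)) : IsCompactOperator (kernelOp k) := by
  refine (isCompactOperator_iff_isCompact_closure_image_closedBall
    (kernelOp k : E →ₗ[ℂ] (X →ᵇ ℂ)) one_pos).mpr ?_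
  refine BoundedContinuousFunction.arzela_ascoli (Metric.closedBall 0 ‖k‖)
    (isCompact_closedBall _ _) _ ?_ ?_
  · rintro _ x ⟨f, hf, rfl⟩
    rw [mem_closedBall_zero_iff] at hf ⊢
    change ‖⟪k x, f⟫_ℂ‖ ≤ ‖k‖
    calc ‖⟪k x, f⟫_ℂ‖ ≤ ‖k x‖ * ‖f‖ := norm_inner_le_norm _ _
      _ ≤ ‖k‖ * 1 := by gcongr; exact k.norm_coe_le_norm x
      _ = ‖k‖ := mul_one _
  · intro x₀
    rw [Metric.equicontinuousAt_iff_right]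
    intro ε hε
    filter_upwards [Metric.continuousAt_iff'.mp k.continuous.continuousAt ε hε] with x hx
    rintro ⟨_, f, hf, rfl⟩
    rw [mem_closedBall_zero_iff] at hf
    change dist (kernelOp k f x₀) (kernelOp k f x) < ε
    rw [dist_comm, dist_eq_norm, kernelOp_apply, kernelOp_apply, ← inner_sub_left]
    calc ‖⟪k x - k x₀, f⟫_ℂ‖ ≤ ‖k x - k x₀‖ * ‖f‖ := norm_inner_le_norm _ _
      _ ≤ ‖k x - k x₀‖ * 1 := by gcongr
      _ < ε := by rwa [mul_one, ← dist_eq_norm]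

end Kernel

/-! ### The operator `f ↦ g · ∫ h f` -/

variable {h : ℝ → ℂ}

lemma prim_eq_integral_indicator (f : ℝ → ℂ) {x : ℝ} (hx : x ∈ Icc (a 1) (a 3)) :
    prim a f x = ∫ t, (Iio x).indicator f t ∂(μ a) := by
  rw [prim, intervalIntegral.integral_of_le hx.1, integral_Ioc_eq_integral_Ioo,
    setIntegral_indicator measurableSet_Ioo, setIntegral_indicator measurableSet_Iio]
  congr 2
  ext t
  simp only [mem_inter_iff, mem_Ioo, mem_Iio]
  exact ⟨fun h => ⟨h.2, h.1.2⟩, fun h => ⟨⟨h.1.1, h.2⟩, h.1⟩⟩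

lemma memLp_cutoff (hh : MemLp h 2 (μ a)) (x : ℝ) :
    MemLp ((Iio x).indicator fun t => (starRingEnd ℂ) (h t)) 2 (μ a) :=
  MemLp.indicator measurableSet_Iio hh.star

lemma integrable_ofReal_norm_sq (hh : MemLp h 2 (μ a)) :
    Integrable (fun t => (‖h t‖ : ℂ) ^ 2) (μ a) := by
  have h2 := ((memLp_two_iff_integrable_sq_norm hh.aestronglyMeasurable).mp hh).ofReal (𝕜 := ℂ)
  simpa using h2

lemma inner_self_eq_ofReal_norm_sq {E : Type*} [NormedAddCommGroup E] [InnerProductSpace ℂ E]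
    (x : E) : ⟪x, x⟫_ℂ = (‖x‖ : ℂ) ^ 2 :=
  inner_self_eq_norm_sq_to_K x

/-- The two cutoffs differ by `h̄` restricted to the interval between `x` and `y`. This gives
continuity of the kernel in the `L²` norm. -/
lemma norm_cutoff_sub_sq (hh : MemLp h 2 (μ a)) {x y : ℝ} (hx : x ∈ Icc (a 1) (a 3))
    (hy : y ∈ Icc (a 1) (a 3)) :
    ‖(memLp_cutoff hh x).toLp - (memLp_cutoff hh y).toLp‖ ^ 2 =
      ‖prim a (fun t => (‖h t‖ : ℂ) ^ 2) x - prim a (fun t => (‖h t‖ : ℂ) ^ 2) y‖ := by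
  wlog hyx : y ≤ x generalizing x y
  · rw [norm_sub_rev, this hy hx (le_of_not_ge hyx), norm_sub_rev]
  have hi := integrable_ofReal_norm_sq hh
  have key : (‖(memLp_cutoff hh x).toLp - (memLp_cutoff hh y).toLp‖ : ℂ) ^ 2 =
      prim a (fun t => (‖h t‖ : ℂ) ^ 2) x - prim a (fun t => (‖h t‖ : ℂ) ^ 2) y := by
    rw [prim_eq_integral_indicator _ hx, prim_eq_integral_indicator _ hy, ← integral_sub
      (hi.indicator measurableSet_Iio) (hi.indicator measurableSet_Iio), ← MemLp.toLp_sub,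
      ← inner_self_eq_ofReal_norm_sq, L2.inner_def]
    refine integral_congr_ae ?_
    filter_upwards [((memLp_cutoff hh x).sub (memLp_cutoff hh y)).coeFn_toLp] with t ht
    rw [ht, inner_self_eq_ofReal_norm_sq, Pi.sub_apply]
    by_cases h1 : t < y
    · rw [indicator_of_mem (mem_Iio.mpr h1), indicator_of_mem (mem_Iio.mpr (h1.trans_le hyx)),
        indicator_of_mem (mem_Iio.mpr h1), indicator_of_mem (mem_Iio.mpr (h1.trans_le hyx))]
      simp
    · rw [indicator_of_notMem (s := Iio y) h1, indicator_of_notMem (s := Iio y) h1]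
      by_cases h2 : t < x
      · rw [indicator_of_mem (mem_Iio.mpr h2), indicator_of_mem (mem_Iio.mpr h2)]
        simp
      · rw [indicator_of_notMem (s := Iio x) h2, indicator_of_notMem (s := Iio x) h2]
        simp
  rw [← key, norm_pow, Complex.norm_real, norm_norm]

/-- The kernel `x ↦ 1_{t < x} h̄(t)` of the operator `f ↦ ∫_{a₂}^x h f`. -/
def cutoff (hh : MemLp h 2 (μ a)) : C(Icc (a 1) (a 3), H a) where
  toFun x := (memLp_cutoff hh x).toLp
  continuous_toFun := by
    rw [continuous_iff_continuousAt]
    intro y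
    rw [ContinuousAt, tendsto_iff_norm_sub_tendsto_zero]
    have hc : Continuous fun x : Icc (a 1) (a 3) =>
        √‖prim a (fun t => (‖h t‖ : ℂ) ^ 2) x - prim a (fun t => (‖h t‖ : ℂ) ^ 2) y‖ :=
      (((continuous_prim (integrable_ofReal_norm_sq hh)).comp continuous_subtype_val).sub
        continuous_const).norm.sqrt
    refine (hc.tendsto' y 0 (by simp)).congr fun x => ?_
    rw [← norm_cutoff_sub_sq hh x.2 y.2, Real.sqrt_sq (norm_nonneg _)]

lemma inner_cutoff (hh : MemLp h 2 (μ a)) (f : H a) (x : Icc (a 1) (a 3)) :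
    ⟪cutoff hh x, f⟫_ℂ = prim a (fun t => h t * f t) x := by
  rw [prim_eq_integral_indicator _ x.2, L2.inner_def]
  refine integral_congr_ae ?_
  filter_upwards [(memLp_cutoff hh (x : ℝ)).coeFn_toLp] with t ht
  change ⟪(memLp_cutoff hh (x : ℝ)).toLp _ t, f t⟫_ℂ = _
  rw [ht, RCLike.inner_apply]
  by_cases h1 : t < x
  · rw [indicator_of_mem (mem_Iio.mpr h1), indicator_of_mem (mem_Iio.mpr h1), Complex.conj_conj,
      mul_comm]
  · rw [indicator_of_notMem (s := Iio (x : ℝ)) h1, indicator_of_notMem (s := Iio (x : ℝ)) h1]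
    simp

variable (a) in
/-- Multiplication of `L²` functions by bounded continuous ones. -/
def mulBCF : (ℝ →ᵇ ℂ) →L[ℂ] H a →L[ℂ] H a :=
  ((ContinuousLinearMap.mul ℂ ℂ).holderL (μ a) ∞ 2 2) ∘L BoundedContinuousFunction.toLp ∞ (μ a) ℂ

lemma coeFn_mulBCF (q : ℝ →ᵇ ℂ) (f : H a) : mulBCF a q f =ᵐ[μ a] fun x => q x * f x := by
  filter_upwards [(ContinuousLinearMap.mul ℂ ℂ).coeFn_holder (r := 2)
    (BoundedContinuousFunction.toLp ∞ (μ a) ℂ q) f,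
    BoundedContinuousFunction.coeFn_toLp ∞ (μ a) ℂ q] with x h1 h2
  rw [← h2]
  exact h1

/-- Extension of continuous functions from `[l, r]` to `ℝ` by constants. -/
def extendCLM {l r : ℝ} (hlr : l ≤ r) : (Icc l r →ᵇ ℂ) →L[ℂ] (ℝ →ᵇ ℂ) where
  toFun q := q.compContinuous ⟨projIcc l r hlr, continuous_projIcc⟩
  map_add' _ _ := rfl
  map_smul' _ _ := rfl
  cont := BoundedContinuousFunction.continuous_compContinuous _

lemma le_of_strictMono (ha : StrictMono a) : a 1 ≤ a 3 :=
  (ha (by decide : (1 : Fin 4) < 3)).le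

/-- The operator `f ↦ g(x) ∫_{a₂}^x h f`. -/
def mulPrim (ha : StrictMono a) (hg : MemLp g 2 (μ a)) (hh : MemLp h 2 (μ a)) : H a →L[ℂ] H a :=
  ((mulBCF a).flip hg.toLp ∘L extendCLM (le_of_strictMono ha)) ∘L kernelOp (cutoff hh)

lemma isCompactOperator_mulPrim (ha : StrictMono a) (hg : MemLp g 2 (μ a))
    (hh : MemLp h 2 (μ a)) : IsCompactOperator (mulPrim ha hg hh) :=
  (isCompactOperator_kernelOp (cutoff hh)).clm_comp
    ((mulBCF a).flip hg.toLp ∘L extendCLM (le_of_strictMono ha))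

lemma coeFn_mulPrim (ha : StrictMono a) (hg : MemLp g 2 (μ a)) (hh : MemLp h 2 (μ a))
    (f : H a) : mulPrim ha hg hh f =ᵐ[μ a] fun x => g x * prim a (fun t => h t * f t) x := by
  filter_upwards [coeFn_mulBCF (extendCLM (le_of_strictMono ha) (kernelOp (cutoff hh) f))
    hg.toLp, hg.coeFn_toLp, ae_restrict_mem measurableSet_Ioo] with x h1 h2 h3
  refine h1.trans ?_
  have e : extendCLM (le_of_strictMono ha) (kernelOp (cutoff hh) f) x =
      prim a (fun t => h t * f t) x := by
    change kernelOp (cutoff hh) f (projIcc _ _ (le_of_strictMono ha) x) = _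
    rw [kernelOp_apply, inner_cutoff, projIcc_of_mem _ (Ioo_subset_Icc_self h3)]
  rw [e, h2, mul_comm]

/-! ### The operator solving `(P ψ')' = f` -/

lemma memLp_one : MemLp (fun _ => (1 : ℂ)) 2 (μ a) := memLp_const 1

/-- The operator `f ↦ ∫_{a₂}^x (v(x) - v(t)) f(t) dt`. -/
def solOp (ha : StrictMono a) : H a →L[ℂ] H a :=
  mulPrim ha (memLp_v ha) memLp_one - mulPrim ha memLp_one (memLp_v ha)

lemma isCompactOperator_solOp (ha : StrictMono a) : IsCompactOperator (solOp ha) :=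
  (isCompactOperator_mulPrim ha (memLp_v ha) memLp_one).sub
    (isCompactOperator_mulPrim ha memLp_one (memLp_v ha))

lemma coeFn_solOp (ha : StrictMono a) (f : H a) : solOp ha f =ᵐ[μ a] sol a 0 f := by
  filter_upwards [coeFn_mulPrim ha (memLp_v ha) memLp_one f,
    coeFn_mulPrim ha memLp_one (memLp_v ha) f,
    Lp.coeFn_sub (mulPrim ha (memLp_v ha) memLp_one f) (mulPrim ha memLp_one (memLp_v ha) f)]
    with x h1 h2 h3
  refine h3.trans ?_
  rw [Pi.sub_apply, h1, h2, sol]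
  simp only [one_mul, zero_add]

lemma conj_prim (f : ℝ → ℂ) {x : ℝ} (hx : x ∈ Icc (a 1) (a 3)) :
    (starRingEnd ℂ) (prim a f x) = prim a (fun t => (starRingEnd ℂ) (f t)) x := by
  rw [prim_eq_integral_indicator _ hx, prim_eq_integral_indicator _ hx, ← integral_conj]
  congr 1
  funext t
  by_cases h1 : t ∈ Iio x
  · rw [indicator_of_mem h1, indicator_of_mem h1]
  · rw [indicator_of_notMem h1, indicator_of_notMem h1, map_zero]

/-- Two integrations by parts; each boundary term carries a factor `∫ f̄` or `∫ g`. -/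
lemma inner_solOp (ha : StrictMono a) {f g : H a} (hf : ∫ x, f x ∂(μ a) = 0)
    (hg : ∫ x, g x ∂(μ a) = 0) : ⟪solOp ha f, g⟫_ℂ = ⟪f, solOp ha g⟫_ℂ := by
  set f' : ℝ → ℂ := fun t => (starRingEnd ℂ) (f t)
  have hf0 : ∫ x, f' x ∂(μ a) = 0 := by rw [integral_conj, hf, map_zero]
  have mf : MemLp f' 2 (μ a) := (Lp.memLp f).star
  have mg : MemLp g 2 (μ a) := Lp.memLp g
  have if1 := integrable_of_memLp mf
  have ig1 := integrable_of_memLp mg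
  have if2 := integrable_v_mul ha mf
  have ig2 := integrable_v_mul ha mg
  have e1 : ⟪solOp ha f, g⟫_ℂ = (∫ x, (v a x * g x) * prim a f' x ∂(μ a)) -
      ∫ x, g x * prim a (fun t => v a t * f' t) x ∂(μ a) := by
    rw [L2.inner_def, ← integral_sub (integrable_mul_prim ig2 if1) (integrable_mul_prim ig1 if2)]
    refine integral_congr_ae ?_
    filter_upwards [coeFn_solOp ha f, ae_restrict_mem measurableSet_Ioo] with x hx hm
    have hm' := Ioo_subset_Icc_self hm
    rw [hx, RCLike.inner_apply, sol, zero_add, map_sub, map_mul, conj_v, conj_prim _ hm',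
      conj_prim _ hm']
    simp only [map_mul, conj_v]
    ring
  have e2 : ⟪f, solOp ha g⟫_ℂ = (∫ x, (v a x * f' x) * prim a g x ∂(μ a)) -
      ∫ x, f' x * prim a (fun t => v a t * g t) x ∂(μ a) := by
    rw [L2.inner_def, ← integral_sub (integrable_mul_prim if2 ig1) (integrable_mul_prim if1 ig2)]
    refine integral_congr_ae ?_
    filter_upwards [coeFn_solOp ha g] with x hx
    rw [hx, RCLike.inner_apply, sol, zero_add]
    ring
  have p1 := integral_mul_prim_add ha ig2 if1
  have p2 := integral_mul_prim_add ha ig1 if2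
  rw [hf0, mul_zero] at p1
  rw [hg, zero_mul] at p2
  rw [e1, e2]
  linear_combination p1 - p2

/-! ### Reduction to the form `A⁻¹ + B` -/

section Reduction

variable {E : Type*} [NormedAddCommGroup E] [InnerProductSpace ℂ E]

/-- If `T - M` has kernel spanned by the unit vector `e`, range `e^⊥` and a compact symmetric
pseudo-inverse `G`, then `T` is of the form `A⁻¹ + B`. -/
lemma exists_isInvCompactAdd {T : E →ₗ.[ℂ] E} {G M : E →L[ℂ] E} {e : E} (he : ‖e‖ = 1)
    (hG : IsCompactOperator G)
    (hGs : ∀ x y, ⟪e, x⟫_ℂ = 0 → ⟪e, y⟫_ℂ = 0 → ⟪G x, y⟫_ℂ = ⟪x, G y⟫_ℂ)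
    (hM : (M : E →ₗ[ℂ] E).IsSymmetric)
    (hT : ∀ p q, (p, q) ∈ T.graph ↔
      ∃ (x : E) (c : ℂ), ⟪e, x⟫_ℂ = 0 ∧ p = c • e + G x ∧ q = x + M p) :
    ∃ A B : E →L[ℂ] E, IsInvCompactAdd T A B := by
  have hee : ⟪e, e⟫_ℂ = 1 := by rw [inner_self_eq_norm_sq_to_K, he]; simp
  let p : E →L[ℂ] E := (ContinuousLinearMap.toSpanSingleton ℂ e) ∘L (innerSL ℂ e)
  have hp : ∀ x, p x = ⟪e, x⟫_ℂ • e := fun x => rfl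
  have hpc : IsCompactOperator p :=
    ((isCompactOperator_id (E := ℂ)).comp_clm (innerSL ℂ e)).clm_comp
      (ContinuousLinearMap.toSpanSingleton ℂ e)
  have hps : ∀ x y, ⟪p x, y⟫_ℂ = ⟪x, p y⟫_ℂ := fun x y => by
    rw [hp, hp, inner_smul_left, inner_smul_right, inner_conj_symm, mul_comm]
  let Q : E →L[ℂ] E := ContinuousLinearMap.id ℂ E - p
  have hQ : ∀ x, Q x = x - p x := fun x => rfl
  have hQe : ∀ x, ⟪e, Q x⟫_ℂ = 0 := fun x => by
    rw [hQ, hp, inner_sub_right, inner_smul_right, hee, mul_one, sub_self]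
  have hQs : ∀ x y, ⟪Q x, y⟫_ℂ = ⟪x, Q y⟫_ℂ := fun x y => by
    rw [hQ, hQ, inner_sub_left, inner_sub_right, hps]
  -- `A` inverts `T - M + p`. Since `G` is symmetric only on `e^⊥`, it is compressed by `Q` on both
  -- sides; the added `p` is subtracted again in `B = M - p`.
  let A : E →L[ℂ] E := Q ∘L G ∘L Q + p
  have hA : ∀ x, A x = Q (G (Q x)) + p x := fun x => rfl
  have hgr : ∀ y, A y = (⟪e, y⟫_ℂ - ⟪e, G (Q y)⟫_ℂ) • e + G (Q y) := fun y => by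
    rw [hA, hQ (G _), hp, hp, sub_smul]
    abel
  refine ⟨A, M - p, ?_, ?_, ?_, ?_, ?_⟩
  · exact ((hG.comp_clm Q).clm_comp Q).add hpc
  · intro x y
    change ⟪A x, y⟫_ℂ = ⟪x, A y⟫_ℂ
    rw [hA, hA, inner_add_left, inner_add_right, hps, hQs, hGs _ _ (hQe x) (hQe y), hQs]
  · intro x y
    have h := hM x y
    change ⟪M x - p x, y⟫_ℂ = ⟪x, M y - p y⟫_ℂ
    rw [inner_sub_left, inner_sub_right, hps]
    congr 1
  · intro y hy
    have h1 : ⟪e, y⟫_ℂ = 0 := by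
      have h := congrArg (fun z => ⟪e, z⟫_ℂ) hy
      simp only [hA, inner_add_right, hQe, zero_add, hp, inner_smul_right, hee, mul_one,
        inner_zero_right] at h
      exact h
    -- As `A y = 0`, single-valuedness of `T` forces `Q y = 0`.
    have hmem : (A y, Q y + M (A y)) ∈ T.graph := (hT _ _).mpr ⟨Q y, _, hQe y, hgr y, rfl⟩
    have h2 := T.graph_fst_eq_zero_snd hmem hy
    rw [hy, map_zero, add_zero, hQ, hp, h1, zero_smul, sub_zero] at h2
    exact h2
  · intro f g
    rw [hT]
    constructor
    · rintro ⟨x, c, hx, rfl, rfl⟩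
      -- The preimage under `A` has `e^⊥`-part `x`, and its `e`-component is that of `c • e + G x`,
      -- because `A` preserves `e`-components.
      have hQx : Q (x + (c + ⟪e, G x⟫_ℂ) • e) = x := by
        rw [hQ, hp, inner_add_right, hx, inner_smul_right, hee]
        simp
      have h1 : ⟪e, x + (c + ⟪e, G x⟫_ℂ) • e⟫_ℂ = c + ⟪e, G x⟫_ℂ := by
        rw [inner_add_right, hx, inner_smul_right, hee]
        simp
      have hAx : A (x + (c + ⟪e, G x⟫_ℂ) • e) = c • e + G x := by
        rw [hgr, hQx, h1, add_sub_cancel_right]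
      refine ⟨_, hAx.symm, ?_⟩
      rw [hAx, sub_apply, hp (c • e + G x), inner_add_right, inner_smul_right, hee, mul_one]
      abel
    · rintro ⟨y, rfl, rfl⟩
      refine ⟨Q y, _, hQe y, hgr y, ?_⟩
      have h1 : p (A y) = p y := by
        rw [hp, hA, inner_add_right, hQe, zero_add, hp, inner_smul_right, hee, mul_one]
      rw [sub_apply, h1, hQ]
      abel

end Reduction

/-! ### The operator `L_S` -/

/-- The bounded potential that agrees with `2 (x - σ)²` on `[a₂, a₄]`. -/
def potential (ha : StrictMono a) : ℝ →ᵇ ℂ :=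
  extendCLM (le_of_strictMono ha) (BoundedContinuousFunction.mkOfCompact
    ⟨fun x : Icc (a 1) (a 3) => 2 * (((x : ℝ) - σ a : ℝ) : ℂ) ^ 2, by fun_prop⟩)

lemma potential_apply (ha : StrictMono a) {x : ℝ} (hx : x ∈ Icc (a 1) (a 3)) :
    potential ha x = 2 * ((x - σ a : ℝ) : ℂ) ^ 2 := by
  change 2 * (((projIcc (a 1) (a 3) (le_of_strictMono ha) x : ℝ) - σ a : ℝ) : ℂ) ^ 2 = _
  rw [projIcc_of_mem _ hx]

lemma coeFn_mulBCF_potential (ha : StrictMono a) (f : H a) :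
    mulBCF a (potential ha) f =ᵐ[μ a] fun x => 2 * ((x - σ a : ℝ) : ℂ) ^ 2 * f x := by
  filter_upwards [coeFn_mulBCF (potential ha) f, ae_restrict_mem measurableSet_Ioo] with x h1 h2
  rw [h1, potential_apply ha (Ioo_subset_Icc_self h2)]

lemma isSymmetric_mulBCF_potential (ha : StrictMono a) :
    (mulBCF a (potential ha) : H a →ₗ[ℂ] H a).IsSymmetric := by
  intro f g
  change ⟪mulBCF a (potential ha) f, g⟫_ℂ = ⟪f, mulBCF a (potential ha) g⟫_ℂ
  rw [L2.inner_def, L2.inner_def]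
  refine integral_congr_ae ?_
  filter_upwards [coeFn_mulBCF_potential ha f, coeFn_mulBCF_potential ha g] with x h1 h2
  rw [h1, h2, RCLike.inner_apply, RCLike.inner_apply]
  simp only [map_mul, map_pow, Complex.conj_ofReal, map_ofNat]
  ring

variable (a) in
/-- The constant function `1` in `L²(a₂, a₄)`. -/
def one : H a := (memLp_one (a := a)).toLp

lemma coeFn_one : one a =ᵐ[μ a] fun _ => (1 : ℂ) := (memLp_one (a := a)).coeFn_toLp

lemma inner_one (f : H a) : ⟪one a, f⟫_ℂ = ∫ x, f x ∂(μ a) := by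
  rw [L2.inner_def]
  refine integral_congr_ae ?_
  filter_upwards [coeFn_one] with x hx
  rw [hx, RCLike.inner_apply, map_one, mul_one]

lemma coeFn_smul_one_add (ha : StrictMono a) (c : ℂ) (f : H a) :
    (c • one a + solOp ha f : H a) =ᵐ[μ a] sol a c f := by
  filter_upwards [Lp.coeFn_add (c • one a) (solOp ha f), Lp.coeFn_smul c (one a),
    coeFn_one, coeFn_solOp ha f] with x h1 h2 h3 h4
  rw [h1, Pi.add_apply, h2, Pi.smul_apply, h3, h4, sol, sol, zero_add, smul_eq_mul, mul_one]

theorem mem_graph_LS_iff (ha : StrictMono a) (p q : H a) : (p, q) ∈ (LS a ha).graph ↔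
    ∃ (f : H a) (c : ℂ), ⟪one a, f⟫_ℂ = 0 ∧ p = c • one a + solOp ha f ∧
      q = f + mulBCF a (potential ha) p := by
  have hL : ∀ (f : H a) (c : ℂ), L a (sol a c f) =ᵐ[μ a]
      (f + mulBCF a (potential ha) (c • one a + solOp ha f) : H a) := fun f c => by
    filter_upwards [L_sol_ae ha (Lp.memLp f) c, coeFn_smul_one_add ha c f,
      coeFn_mulBCF_potential ha (c • one a + solOp ha f),
      Lp.coeFn_add f (mulBCF a (potential ha) (c • one a + solOp ha f))] with x h1 h2 h3 h4
    rw [h1, h4, Pi.add_apply, h3, h2]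
  have hmpr : ∀ (f : H a) (c : ℂ), ⟪one a, f⟫_ℂ = 0 → (c • one a + solOp ha f,
      f + mulBCF a (potential ha) (c • one a + solOp ha f)) ∈ (LS a ha).graph := fun f c h0 => by
    rw [inner_one] at h0
    exact mem_graph_LS.mpr ⟨sol a c f, memDomain_sol ha (Lp.memLp f) h0 c,
      coeFn_smul_one_add ha c f, (hL f c).symm⟩
  constructor
  · intro hpq
    obtain ⟨ψ, hψ, hp, -⟩ := mem_graph_LS.mp hpq
    obtain ⟨f, c, hf, hf0, hψf⟩ := hψ.exists_eq_sol ha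
    have hff : hf.toLp =ᵐ[μ a] f := hf.coeFn_toLp
    have hsol : sol a c hf.toLp = sol a c f := by
      have h2 : (fun t => v a t * hf.toLp f t) =ᵐ[μ a] fun t => v a t * f t := by
        filter_upwards [hff] with t ht
        rw [ht]
      funext x
      rw [sol, sol, prim_congr hff, prim_congr h2]
    have hpe : p = c • one a + solOp ha hf.toLp := by
      refine Lp.ext ?_
      rw [← hsol] at hψf
      exact (hp.trans hψf).trans (coeFn_smul_one_add ha c _).symm
    have h0 : ⟪one a, hf.toLp⟫_ℂ = 0 := by
      rw [inner_one, integral_congr_ae hff, hf0]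
    refine ⟨hf.toLp, c, h0, hpe, ?_⟩
    -- The second component need not be recomputed, since the graph is single-valued.
    have h1 := hmpr hf.toLp c h0
    rw [← hpe] at h1
    exact (LS a ha).mem_graph_snd_inj hpq h1 rfl
  · rintro ⟨f, c, h0, rfl, rfl⟩
    exact hmpr f c h0

theorem exists_isInvCompactAdd_LS (ha : StrictMono a) :
    ∃ A B : H a →L[ℂ] H a, IsInvCompactAdd (LS a ha) A B := by
  have h1 : ‖one a‖ ≠ 0 := by
    intro h
    have h2 := inner_one (one a)
    rw [show ⟪one a, one a⟫_ℂ = 0 by rw [norm_eq_zero.mp h, inner_zero_left],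
      integral_congr_ae coeFn_one] at h2
    have h13 : a 1 < a 3 := ha (by decide)
    simp [Measure.real, ENNReal.toReal_ofReal, sub_nonneg.mpr h13.le] at h2
    exact h13.ne' (sub_eq_zero.mp (by exact_mod_cast h2.symm))
  have h1' : (‖one a‖ : ℂ) ≠ 0 := by exact_mod_cast h1
  have he : ∀ f : H a, ⟪(‖one a‖ : ℂ)⁻¹ • one a, f⟫_ℂ = 0 ↔ ⟪one a, f⟫_ℂ = 0 := fun f => by
    rw [inner_smul_left, mul_eq_zero, or_iff_right]
    rw [map_inv₀, Complex.conj_ofReal]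
    exact inv_ne_zero h1'
  refine exists_isInvCompactAdd (e := (‖one a‖ : ℂ)⁻¹ • one a)
    (by simp [norm_smul, h1]) (isCompactOperator_solOp ha) (fun f g hf hg => ?_)
    (isSymmetric_mulBCF_potential ha) (fun p q => ?_)
  · rw [he, inner_one] at hf hg
    exact inner_solOp ha hf hg
  · rw [mem_graph_LS_iff]
    constructor
    · rintro ⟨f, c, h0, hp, hq⟩
      refine ⟨f, c * ‖one a‖, (he f).mpr h0, ?_, hq⟩
      rw [smul_smul, mul_inv_cancel_right₀ h1', hp]
    · rintro ⟨f, c, h0, hp, hq⟩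
      exact ⟨f, c * (‖one a‖ : ℂ)⁻¹, (he f).mp h0, by rw [mul_smul, hp], hq⟩

instance separableSpace_H (a : Fin 4 → ℝ) : TopologicalSpace.SeparableSpace (H a) := by
  have : Fact ((2 : ℝ≥0∞) ≠ ∞) := ⟨by simp⟩
  have : SecondCountableTopology (H a) := Lp.SecondCountableTopology
  infer_instance

/-- `L²(a₂, a₄)` is infinite-dimensional. -/
lemma not_finiteDimensional_H (ha : StrictMono a) : ¬ FiniteDimensional ℂ (H a) := by
  intro hfin
  have h13 : a 1 < a 3 := ha (by decide)
  -- The points decrease from `a 3` towards `a 1`. Indicators of the successive gaps are nonzero and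
  -- pairwise orthogonal.
  let d : ℕ → ℝ := fun n => a 1 + (a 3 - a 1) / (n + 1)
  have hd : ∀ n, d n = a 1 + (a 3 - a 1) / (n + 1) := fun _ => rfl
  have hdpos : ∀ n, a 1 < d n := fun n => by
    have : 0 < (a 3 - a 1) / ((n : ℝ) + 1) := div_pos (sub_pos.mpr h13) (by positivity)
    rw [hd]
    linarith
  have hanti : StrictAnti d := strictAnti_nat_of_succ_lt fun n => by
    have : (a 3 - a 1) / ((n : ℝ) + 1 + 1) < (a 3 - a 1) / ((n : ℝ) + 1) :=
      div_lt_div_of_pos_left (sub_pos.mpr h13) (by positivity) (by linarith)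
    rw [hd, hd]
    push_cast
    linarith
  have hle : ∀ n, d n ≤ a 3 := fun n => by
    refine (hanti.antitone (Nat.zero_le n)).trans ?_
    rw [hd]
    simp
  let s : ℕ → Set ℝ := fun n => Ioo (d (n + 1)) (d n)
  have hs : ∀ n, MeasurableSet (s n) := fun n => measurableSet_Ioo
  let F : ℕ → H a := fun n => indicatorConstLp 2 (hs n) (measure_ne_top (μ a) _) (1 : ℂ)
  have hF0 : ∀ n, F n ≠ 0 := fun n h => by
    have h2 : ‖F n‖ = 0 := by rw [h, norm_zero]
    rw [norm_indicatorConstLp (by simp) (by simp)] at h2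
    have h3 : (μ a).real (s n) = d n - d (n + 1) := by
      rw [Measure.real, Measure.restrict_apply (hs n),
        inter_eq_self_of_subset_left (Ioo_subset_Ioo (hdpos _).le (hle _)), Real.volume_Ioo,
        ENNReal.toReal_ofReal (sub_nonneg.mpr (hanti n.lt_succ_self).le)]
    rw [h3, norm_one, one_mul] at h2
    exact (Real.rpow_pos_of_pos (sub_pos.mpr (hanti n.lt_succ_self)) _).ne' h2
  have hF : ∀ m n, m < n → ⟪F m, F n⟫_ℂ = 0 := fun m n hmn => by
    rw [L2.inner_indicatorConstLp_one, ← integral_indicator (hs m)]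
    refine integral_eq_zero_of_ae ?_
    filter_upwards [indicatorConstLp_coeFn_notMem (p := 2) (hs := hs n)
      (hμs := measure_ne_top (μ a) _) (c := (1 : ℂ))] with x hx
    by_cases hm : x ∈ s m
    · rw [indicator_of_mem hm]
      refine hx fun hn => ?_
      exact lt_asymm (hn.2.trans_le (hanti.antitone hmn)) hm.1
    · rw [indicator_of_notMem hm, Pi.zero_apply]
  have hli : LinearIndependent ℂ F := by
    refine linearIndependent_of_ne_zero_of_inner_eq_zero hF0 fun m n hmn => ?_
    rcases lt_or_gt_of_ne hmn with h | h
    · exact hF m n h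
    · rw [inner_eq_zero_symm]
      exact hF n m h
  exact not_finite_iff_infinite.mpr inferInstance hli.finite_of_isNoetherian

end TruncatedHilbert

end

theorem mainTheorem3 (a : Fin 4 → ℝ) (ha : StrictMono a) :
    IsSelfAdjoint (TruncatedHilbert.LS a ha) ∧
    (∃ R : TruncatedHilbert.H a →L[ℂ] TruncatedHilbert.H a,
      TruncatedHilbert.IsResolventAt (TruncatedHilbert.LS a ha) Complex.I R ∧
        IsCompactOperator R) ∧
    TruncatedHilbert.HasPurelyDiscreteSpectrum (TruncatedHilbert.LS a ha) ∧
    ∃ (f : HilbertBasis ℕ ℂ (TruncatedHilbert.H a)) (lam : ℕ → ℝ),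
      ∀ n, f n ∈ TruncatedHilbert.eigenspace (TruncatedHilbert.LS a ha) (lam n : ℂ) := by
  obtain ⟨A, B, h⟩ := TruncatedHilbert.exists_isInvCompactAdd_LS ha
  exact ⟨h.isSelfAdjoint, h.exists_compact_resolvent (h.eigenspace_eq_bot (by simp)),
    h.hasPurelyDiscreteSpectrum,
    h.exists_hilbertBasis (TruncatedHilbert.not_finiteDimensional_H ha)⟩
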